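/- Let $n\ge 1$ and let $f_1,\dots,f_n:\mathbb{R}^p\to\mathbb{R}$ be twice continuously differentiable. Suppose there are constants $0<\mu\le L$ and $\tilde L>0$ such that for all $i$ and all $x,\hat x\in\mathbb{R}^p$ $$\mu\|x-\hat x\|^2\le(\nabla f_i(x)-\nabla f_i(\hat x))^T(x-\hat x)\le L\|x-\hat x\|^2,\qquad \|\nabla^2 f_i(x)-\nabla^2 f_i(\hat x)\|\le\tilde L\|x-\hat x\|,$$ where $\|\cdot\|$ is the Euclidean norm of vectors and the induced operator norm of matrices. Let $x^*$ be the minimizer of $f=\frac1n\sum_{i=1}^n f_i$. Given $x^0\in\mathbb{R}^p$ and symmetric positive definite matrices $B_1^0,\dots,B_n^0$, the incremental quasi-Newton (IQN) method sets $z_1^0=\dots=z_n^0=x^0$ and, for $t=0,1,2,\dots$ and $i_t=(t\bmod n)+1$, $$x^{t+1}=\Big(\frac1n\sum_{i=1}^nB_i^t\Big)^{-1}\Big[\frac1n\sum_{i=1}^nB_i^tz_i^t-\frac1n\sum_{i=1}^n\nabla f_i(z_i^t)\Big],$$ $z_{i_t}^{t+1}=x^{t+1}$, and, with $i=i_t$,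 $s=z_i^{t+1}-z_i^t$ and $y=\nabla f_i(z_i^{t+1})-\nabla f_i(z_i^t)$, $$B_i^{t+1}=B_i^t+\frac{yy^T}{y^Ts}-\frac{B_i^tss^TB_i^t}{s^TB_i^ts}\quad(\text{and } B_i^{t+1}=B_i^t \text{ if } s=0),$$ while $z_j^{t+1}=z_j^t$ and $B_j^{t+1}=B_j^t$ for all $j\ne i_t$. Then there are $\varepsilon,\delta>0$ such that the following holds for all $x^0$ and all symmetric positive definite $B_1^0,\dots,B_n^0$ with $\|x^0-x^*\|<\varepsilon$ and $\|M_i(B_i^0-\nabla^2f_i(x^*))M_i\|_F<\delta$ for $i=1,\dots,n$, where $M_i=\nabla^2f_i(x^*)^{-1/2}$ and $\|\cdot\|_F$ is the Frobenius norm. (1) There are indices $\varphi(0)<\varphi(1)<\cdots$ such that $\varphi(k)$ maximizes $\|x^u-x^*\|$ over $u\in\{kn,\dots,kn+n-1\}$ for every $k\ge0$, and the subsequence $e_k=\|x^{\varphi(k)}-x^*\|$ converges to $0$ Q-superlinearly: $e_k\to0$ and $e_{k+1}=o(e_k)$ as $k\to\infty$ (that is, $e_{k+1}/e_k\to0$ if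 no $e_k$ vanishes). (2) There is a sequence $\zeta^t>0$ with $\|x^t-x^*\|\le\zeta^t$ for all $t\ge0$, $\zeta^t\to0$ and $\zeta^{t+1}/\zeta^t\to0$ as $t\to\infty$; that is, the errors $\|x^t-x^*\|$ converge to $0$ R-superlinearly. -/

import Mathlib

open Filter Topology Asymptotics

noncomputable section

/-- The action of a matrix on a vector of Euclidean space. -/
def applyMat {p : ℕ} (A : Matrix (Fin p) (Fin p) ℝ) (v : EuclideanSpace ℝ (Fin p)) :
    EuclideanSpace ℝ (Fin p) :=
  Matrix.toEuclideanCLM (n := Fin p) (𝕜 := ℝ) A v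

/-- The rank-one matrix `u vᵀ`. -/
def outer {p : ℕ} (u v : EuclideanSpace ℝ (Fin p)) : Matrix (Fin p) (Fin p) ℝ :=
  Matrix.vecMulVec u.ofLp v.ofLp

/-- The spectral norm of a matrix: its operator norm for the Euclidean vector norm. -/
def specNorm {p : ℕ} (A : Matrix (Fin p) (Fin p) ℝ) : ℝ :=
  ‖Matrix.toEuclideanCLM (n := Fin p) (𝕜 := ℝ) A‖

/-- The Hessian matrix of `g` at `x`: the matrix of the derivative of the gradient. -/
def hessian {p : ℕ} (g : EuclideanSpace ℝ (Fin p) → ℝ) (x : EuclideanSpace ℝ (Fin p)) :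
    Matrix (Fin p) (Fin p) ℝ :=
  (Matrix.toEuclideanCLM (n := Fin p) (𝕜 := ℝ)).symm (fderiv ℝ (gradient g) x)

section Norms

open scoped Matrix.Norms.Frobenius

/-- The weighted norm `‖A‖_M = ‖M A M‖_F`, where `‖·‖_F` is the Frobenius norm. -/
def weightedNorm {p : ℕ} (M A : Matrix (Fin p) (Fin p) ℝ) : ℝ :=
  ‖M * A * M‖

end Norms

section Sqrt

open scoped MatrixOrder

/-- The inverse square root `H^(-1/2)` of a positive definite matrix `H`, that is, the inverse
of its positive semidefinite square root. -/
def invSqrt {p : ℕ} (H : Matrix (Fin p) (Fin p) ℝ) : Matrix (Fin p) (Fin p) ℝ :=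
  (CFC.sqrt H)⁻¹

end Sqrt

/-- The BFGS update `B + y yᵀ / (yᵀ s) - (B s sᵀ B) / (sᵀ B s)`. If `s = 0` (and hence `y = 0`,
when `y` is the gradient variation along `s`) both corrections vanish, so that the matrix is left
unchanged. -/
def bfgsUpdate {p : ℕ} (B : Matrix (Fin p) (Fin p) ℝ) (s y : EuclideanSpace ℝ (Fin p)) :
    Matrix (Fin p) (Fin p) ℝ :=
  B + (inner ℝ y s)⁻¹ • outer y y - (inner ℝ s (applyMat B s))⁻¹ • (B * outer s s * B)

/-- The information held by the incremental quasi-Newton (IQN) method at one time: the current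
iterate `x`, the copies `z i` of the variable and the Hessian approximations `B i`. (The stored
gradients are the gradients of `f i` at `z i`.) -/
structure IQNState (n p : ℕ) where
  x : EuclideanSpace ℝ (Fin p)
  z : Fin n → EuclideanSpace ℝ (Fin p)
  B : Fin n → Matrix (Fin p) (Fin p) ℝ

/-- The next iterate
`((1/n) ∑ B i)⁻¹ ((1/n) ∑ (B i) (z i) - (1/n) ∑ ∇ (f i) (z i))`. -/
def iqnNext {n p : ℕ} (f : Fin n → EuclideanSpace ℝ (Fin p) → ℝ) (S : IQNState n p) :
    EuclideanSpace ℝ (Fin p) :=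
  applyMat ((1 / (n : ℝ)) • ∑ i, S.B i)⁻¹
    ((1 / (n : ℝ)) • ∑ i, applyMat (S.B i) (S.z i) -
      (1 / (n : ℝ)) • ∑ i, gradient (f i) (S.z i))

/-- Step `t` of IQN. The functions are numbered from `0`, so that the function updated at time `t`
is the one with index `t % n`; the information on the other functions is kept. -/
def iqnStep {n p : ℕ} (f : Fin n → EuclideanSpace ℝ (Fin p) → ℝ) (t : ℕ) (S : IQNState n p) :
    IQNState n p where
  x := iqnNext f S
  z := fun i => if (i : ℕ) = t % n then iqnNext f S else S.z i
  B := fun i =>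
    if (i : ℕ) = t % n then
      bfgsUpdate (S.B i) (iqnNext f S - S.z i)
        (gradient (f i) (iqnNext f S) - gradient (f i) (S.z i))
    else S.B i

/-- The states of IQN started at the point `x₀` with the Hessian approximations `B₀`. -/
def iqn {n p : ℕ} (f : Fin n → EuclideanSpace ℝ (Fin p) → ℝ) (x₀ : EuclideanSpace ℝ (Fin p))
    (B₀ : Fin n → Matrix (Fin p) (Fin p) ℝ) : ℕ → IQNState n p
  | 0 => ⟨x₀, fun _ => x₀, B₀⟩
  | t + 1 => iqnStep f t (iqn f x₀ B₀ t)

/-- The error `‖x^t - x^*‖` of the `t`-th iterate of IQN. -/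
def iqnError {n p : ℕ} (f : Fin n → EuclideanSpace ℝ (Fin p) → ℝ)
    (x₀ : EuclideanSpace ℝ (Fin p)) (B₀ : Fin n → Matrix (Fin p) (Fin p) ℝ)
    (xstar : EuclideanSpace ℝ (Fin p)) (t : ℕ) : ℝ :=
  ‖(iqn f x₀ B₀ t).x - xstar‖

/-- Q-superlinear convergence of `a` to zero: `a k → 0` and `a (k + 1) = o(a k)`. Where no term
of `a` vanishes this says that `a (k + 1) / a k → 0`; it also makes sense for sequences that reach
zero after finitely many steps. -/
def QSuperlinearToZero (a : ℕ → ℝ) : Prop :=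
  Tendsto a atTop (𝓝 0) ∧ (fun k => a (k + 1)) =o[atTop] a

end

/-!
Superlinear convergence of IQN follows from two facts about the BFGS update and one about the
iteration.

*The BFGS update.* Changing variables by the square root of a positive definite matrix `H` turns
the weighted norm of `B - H` into the Frobenius norm of `C - 1`. If `y = s`, a computation with
traces gives, with `v = C s`, `b = ⟪s, v⟫`, `N = ⟪v, v⟫` and `w = ⟪v, C v⟫`,
`‖C⁺ - 1‖² = ‖C - 1‖² - (b - 2 N + w) / b - (w / b - (N / b)²)`.
The first subtracted term is `⟪d, C d⟫ / b` with `d = (C - 1) s`, the second is nonnegative by the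
Cauchy–Schwarz inequality. So the update moves `C` towards the identity, by an amount quadratic in
`θ = ‖(C - 1) s‖ / ‖s‖`, and a secant error `‖y - s‖ ≤ σ ‖s‖` costs at most `7 σ`
(`weightedNorm_bfgsUpdate_sub_le`). For a gradient difference `y`, the Lipschitz continuity of the
Hessian bounds `σ` by a multiple of the distance of the two points to the minimizer
(`exists_weightedNorm_bfgsUpdate_le`).

*Linear convergence.* The next error is bounded by the mean of
`‖(B i - H i) (z i - xstar)‖ + Lt ‖z i - xstar‖²` over the functions
(`IsIQNProblem.norm_iqnNext_sub_le`). While all `B i` are close to the Hessians `H i`, the errors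
decay geometrically, so the secant errors are summable, so the `B i` stay close
(`IsIQNProblem.linear_convergence`). Summing the decreases shows moreover that `θ → 0`, the
Dennis–Moré property (`IsIQNProblem.exists_dennisMore`).

*Superlinear convergence.* The Dennis–Moré property concerns the step `s = x' - z i` of the *next*
update of function `i`, whereas the bound on the error involves `z i - xstar = (x' - xstar) - s`.
The term `(B i - H i) (x' - xstar)` is a small multiple of the error of the later iterate `x'`. So
each error is at most `o(1)` times the maximum over the preceding window of `n` errors plus half of
the maximum over the following window, and the latter is absorbed
(`eventually_windowMax_add_le`). Hence the maximum over a window is of smaller order than the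
maximum over the window before it; this is the Q-superlinear convergence of the block maxima. A
geometric interpolation of the window maxima gives the R-superlinear majorant
(`exists_majorant_ratio_tendsto_zero`).
-/

/-! ### Nonnegative sequences and their maxima over windows -/

/-- The maximum of `e` over the window `t, …, t + n - 1`. For `n = 0` the value is the junk value
`0` of an empty supremum. -/
noncomputable def windowMax (e : ℕ → ℝ) (n t : ℕ) : ℝ := ⨆ j : Fin n, e (t + j)

lemma le_windowMax (e : ℕ → ℝ) {n u : ℕ} (t : ℕ) (h₁ : t ≤ u) (h₂ : u < t + n) :
    e u ≤ windowMax e n t := by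
  have := le_ciSup (f := fun j : Fin n => e (t + j)) (Set.finite_range _).bddAbove
    ⟨u - t, by omega⟩
  simpa [windowMax, Nat.add_sub_cancel' h₁] using this

lemma windowMax_le {e : ℕ → ℝ} {n t : ℕ} (hn : 0 < n) {a : ℝ}
    (h : ∀ u, t ≤ u → u < t + n → e u ≤ a) : windowMax e n t ≤ a := by
  have : Nonempty (Fin n) := ⟨⟨0, hn⟩⟩
  exact ciSup_le fun j => h _ (by omega) (by omega)

lemma windowMax_antitone {e : ℕ → ℝ} {n : ℕ} (hn : 0 < n)
    (h : ∀ t, e (t + n) ≤ windowMax e n t) : Antitone (windowMax e n) := by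
  refine antitone_nat_of_succ_le fun t => windowMax_le hn fun u h₁ h₂ => ?_
  rcases Nat.lt_or_ge u (t + n) with hu | hu
  · exact le_windowMax e t (by omega) hu
  · obtain rfl : u = t + n := by omega
    exact h t

/-- If each term is at most an arbitrarily small multiple of the maximum over the preceding window
plus half of the maximum over the window that it opens, then passing to the next window reduces
the maximum by arbitrarily small factors. The maximum over the later window is absorbed because
the window maxima decrease. -/
lemma eventually_windowMax_add_le {e : ℕ → ℝ} {n : ℕ} (hn : 0 < n)
    (h : ∀ t, e (t + n) ≤ windowMax e n t)
    (hs : ∀ κ > 0, ∀ᶠ t in atTop,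
      e (t + n) ≤ κ * windowMax e n t + 1 / 2 * windowMax e n (t + n)) :
    ∀ κ > 0, ∀ᶠ t in atTop, windowMax e n (t + n) ≤ κ * windowMax e n t := by
  intro κ hκ
  obtain ⟨T, hT⟩ := eventually_atTop.1 (hs (κ / 2) (by positivity))
  filter_upwards [eventually_ge_atTop T] with t ht
  have hanti := windowMax_antitone hn h
  suffices windowMax e n (t + n) ≤
      κ / 2 * windowMax e n t + 1 / 2 * windowMax e n (t + n) by linarith
  refine windowMax_le hn fun u h₁ h₂ => ?_
  obtain ⟨v, rfl⟩ : ∃ v, u = v + n := ⟨u - n, by omega⟩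
  refine (hT v (by omega)).trans ?_
  gcongr <;> exact hanti (by omega)

/-- The majorant is the supremum over the tails of the sequence. -/
lemma exists_antitone_majorant {r : ℕ → ℝ} (hr : Tendsto r atTop (𝓝 0)) :
    ∃ η : ℕ → ℝ, Antitone η ∧ (∀ t, r t ≤ η t) ∧ Tendsto η atTop (𝓝 0) := by
  have hb : ∀ t, BddAbove (Set.range fun u => r (t + u)) := fun t =>
    hr.bddAbove_range.mono (by rintro _ ⟨u, rfl⟩; exact ⟨_, rfl⟩)
  have hle : ∀ t, r t ≤ ⨆ u, r (t + u) := fun t => by simpa using le_ciSup (hb t) 0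
  refine ⟨fun t => ⨆ u, r (t + u), ?_, hle, ?_⟩
  · refine antitone_nat_of_succ_le fun t => ciSup_le fun u => ?_
    have := le_ciSup (hb t) (1 + u)
    simpa [add_assoc] using this
  · refine tendsto_order.2 ⟨fun a ha => ?_, fun a ha => ?_⟩
    · filter_upwards [(tendsto_order.1 hr).1 a ha] with t ht using ht.trans_le (hle t)
    · obtain ⟨T, hT⟩ := eventually_atTop.1 ((tendsto_order.1 hr).2 (a / 2) (half_pos ha))
      filter_upwards [eventually_ge_atTop T] with t ht
      exact (ciSup_le fun u => (hT (t + u) (by omega)).le).trans_lt (half_lt_self ha)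

/-- A decreasing sequence that is multiplied by arbitrarily small factors every `n` steps lies
below a positive sequence whose consecutive ratios tend to zero. The majorant is a product of
`n`-th roots of the factors; delaying the factors by `n` steps keeps it above the sequence. -/
lemma exists_majorant_ratio_tendsto_zero {W : ℕ → ℝ} {n : ℕ} (hn : 0 < n) (hW : ∀ t, 0 ≤ W t)
    (hanti : Antitone W) (hs : ∀ κ > 0, ∀ᶠ t in atTop, W (t + n) ≤ κ * W t) :
    ∃ ζ : ℕ → ℝ, (∀ t, 0 < ζ t) ∧ (∀ t, W t ≤ ζ t) ∧ Tendsto ζ atTop (𝓝 0) ∧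
      Tendsto (fun t => ζ (t + 1) / ζ t) atTop (𝓝 0) := by
  have hr₀ : Tendsto (fun t => W (t + n) / W t) atTop (𝓝 0) := by
    refine tendsto_order.2 ⟨fun a ha => Eventually.of_forall fun t =>
      ha.trans_le (div_nonneg (hW _) (hW _)), fun a ha => ?_⟩
    filter_upwards [hs (a / 2) (half_pos ha)] with t ht
    exact (div_le_of_le_mul₀ (hW t) (half_pos ha).le ht).trans_lt (half_lt_self ha)
  -- The summand `1 / (t + 1)` makes the factors positive.
  have hr : Tendsto (fun t : ℕ => W (t + n) / W t + 1 / ((t : ℝ) + 1)) atTop (𝓝 0) := by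
    simpa only [add_zero] using hr₀.add tendsto_one_div_add_atTop_nhds_zero_nat
  obtain ⟨η, hη, hrη, hη₀⟩ := exists_antitone_majorant hr
  have hηpos : ∀ t, 0 < η t := fun t =>
    (add_pos_of_nonneg_of_pos (div_nonneg (hW _) (hW _)) Nat.one_div_pos_of_nat).trans_le (hrη t)
  have hstep : ∀ t, W (t + n) ≤ η t * W t := fun t => by
    rcases (hW t).eq_or_lt with h | h
    · rw [← h, mul_zero, h]; exact hanti (by omega)
    · rw [← div_le_iff₀ h]
      exact (le_add_of_nonneg_right Nat.one_div_pos_of_nat.le).trans (hrη t)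
  set θ : ℕ → ℝ := fun t => η (t - n) ^ (1 / (n : ℝ)) with hθ
  have hθpos : ∀ t, 0 < θ t := fun t => Real.rpow_pos_of_pos (hηpos _) _
  have hθ₀ : Tendsto θ atTop (𝓝 0) := by
    have h1 : 0 < 1 / (n : ℝ) := by positivity
    have := (hη₀.comp (tendsto_sub_atTop_nat n)).rpow_const (p := 1 / (n : ℝ)) (Or.inr h1.le)
    rwa [Real.zero_rpow h1.ne'] at this
  set P : ℕ → ℝ := fun t => ∏ j ∈ Finset.range t, θ j with hP
  have hPpos : ∀ t, 0 < P t := fun t => Finset.prod_pos fun j _ => hθpos j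
  set C : ℝ := 1 + ∑ t ∈ Finset.range n, W t / P t with hC
  have hCpos : 0 < C := by
    have := Finset.sum_nonneg fun t (_ : t ∈ Finset.range n) => div_nonneg (hW t) (hPpos t).le
    linarith
  have hratio : ∀ t, C * P (t + 1) / (C * P t) = θ t := fun t => by
    have h1 := (hPpos t).ne'
    have h2 := hCpos.ne'
    simp only [hP, Finset.prod_range_succ] at h1 ⊢
    field_simp
  refine ⟨fun t => C * P t, fun t => mul_pos hCpos (hPpos t), fun t => ?_, ?_, ?_⟩
  · induction t using Nat.strong_induction_on with
    | _ t ih =>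
      rcases Nat.lt_or_ge t n with h | h
      · have h1 := Finset.single_le_sum (f := fun t => W t / P t)
          (fun t _ => div_nonneg (hW t) (hPpos t).le) (Finset.mem_range.2 h)
        have h2 : W t / P t ≤ C := by linarith
        exact (div_le_iff₀ (hPpos t)).1 h2
      · obtain ⟨s, rfl⟩ : ∃ s, t = s + n := ⟨t - n, by omega⟩
        have hprod : η s * P s ≤ P (s + n) := by
          have h1 : P (s + n) = P s * ∏ j ∈ Finset.range n, θ (s + j) := by
            simp only [hP, Finset.prod_range_add]
          have h2 : η s ≤ ∏ j ∈ Finset.range n, θ (s + j) := by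
            calc η s = ∏ j ∈ Finset.range n, η s ^ (1 / (n : ℝ)) := by
                  rw [Finset.prod_const, Finset.card_range, ← Real.rpow_natCast,
                    ← Real.rpow_mul (hηpos s).le, one_div_mul_cancel (by positivity),
                    Real.rpow_one]
              _ ≤ _ := by
                  refine Finset.prod_le_prod (fun _ _ => (Real.rpow_pos_of_pos (hηpos _) _).le)
                    fun j hj => ?_
                  have := Finset.mem_range.1 hj
                  exact Real.rpow_le_rpow (hηpos _).le (hη (by omega)) (by positivity)
          rw [h1, mul_comm]
          exact mul_le_mul_of_nonneg_left h2 (hPpos s).le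
        calc W (s + n) ≤ η s * W s := hstep s
          _ ≤ η s * (C * P s) := mul_le_mul_of_nonneg_left (ih s (by omega)) (hηpos s).le
          _ = C * (η s * P s) := by ring
          _ ≤ C * P (s + n) := mul_le_mul_of_nonneg_left hprod hCpos.le
  · have hsum : Summable fun t => C * P t := by
      refine summable_of_ratio_test_tendsto_lt_one zero_lt_one
        (Eventually.of_forall fun t => (mul_pos hCpos (hPpos t)).ne') ?_
      refine hθ₀.congr fun t => ?_
      rw [Real.norm_of_nonneg (mul_pos hCpos (hPpos _)).le,
        Real.norm_of_nonneg (mul_pos hCpos (hPpos _)).le, hratio]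
    exact hsum.tendsto_atTop_zero
  · exact hθ₀.congr fun t => (hratio t).symm

/-- A nonnegative sequence that loses `d t` at each step, up to increments with bounded partial
sums, can only lose amounts that tend to zero. -/
lemma tendsto_zero_of_telescoping {T d a : ℕ → ℝ} {A : ℝ} (hT : ∀ t, 0 ≤ T t) (hd : ∀ t, 0 ≤ d t)
    (hA : ∀ t, ∑ u ∈ Finset.range t, a u ≤ A) (h : ∀ t, T (t + 1) ≤ T t - d t + a t) :
    Tendsto d atTop (𝓝 0) := by
  have key : ∀ t, T t + ∑ u ∈ Finset.range t, d u ≤ T 0 + ∑ u ∈ Finset.range t, a u := by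
    intro t
    induction t with
    | zero => simp
    | succ t ih =>
      rw [Finset.sum_range_succ, Finset.sum_range_succ]
      linarith [h t]
  have : Summable d := summable_of_sum_range_le (c := T 0 + A) hd fun t => by
    linarith [key t, hT t, hA t]
  exact this.tendsto_atTop_zero

/-! ### Matrices acting on Euclidean space -/

section applyMat

variable {p : ℕ}

lemma applyMat_sub (A : Matrix (Fin p) (Fin p) ℝ) (u v : EuclideanSpace ℝ (Fin p)) :
    applyMat A (u - v) = applyMat A u - applyMat A v := by simp [applyMat]

lemma applyMat_smul (A : Matrix (Fin p) (Fin p) ℝ) (a : ℝ) (v : EuclideanSpace ℝ (Fin p)) :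
    applyMat A (a • v) = a • applyMat A v := by simp [applyMat]

lemma applyMat_zero (A : Matrix (Fin p) (Fin p) ℝ) : applyMat A 0 = 0 := by simp [applyMat]

lemma sub_applyMat (A B : Matrix (Fin p) (Fin p) ℝ) (v : EuclideanSpace ℝ (Fin p)) :
    applyMat (A - B) v = applyMat A v - applyMat B v := by simp [applyMat]

lemma smul_applyMat (a : ℝ) (A : Matrix (Fin p) (Fin p) ℝ) (v : EuclideanSpace ℝ (Fin p)) :
    applyMat (a • A) v = a • applyMat A v := by simp [applyMat]

lemma sum_applyMat {ι : Type*} (s : Finset ι) (A : ι → Matrix (Fin p) (Fin p) ℝ)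
    (v : EuclideanSpace ℝ (Fin p)) :
    applyMat (∑ i ∈ s, A i) v = ∑ i ∈ s, applyMat (A i) v := by simp [applyMat]

lemma one_applyMat (v : EuclideanSpace ℝ (Fin p)) : applyMat 1 v = v := by simp [applyMat]

lemma mul_applyMat (A B : Matrix (Fin p) (Fin p) ℝ) (v : EuclideanSpace ℝ (Fin p)) :
    applyMat (A * B) v = applyMat A (applyMat B v) := by simp [applyMat]

lemma inner_applyMat_comm {A : Matrix (Fin p) (Fin p) ℝ} (hA : A.IsSymm)
    (u v : EuclideanSpace ℝ (Fin p)) :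
    inner ℝ (applyMat A u) v = inner ℝ u (applyMat A v) := by
  rw [applyMat, applyMat, real_inner_comm, Matrix.inner_toEuclideanCLM,
    Matrix.inner_toEuclideanCLM, Matrix.dotProduct_mulVec, ← Matrix.mulVec_transpose, hA.eq,
    dotProduct_comm]

lemma mul_outer_mul {A : Matrix (Fin p) (Fin p) ℝ} (hA : A.IsSymm)
    (u v : EuclideanSpace ℝ (Fin p)) :
    A * outer u v * A = outer (applyMat A u) (applyMat A v) := by
  rw [outer, Matrix.mul_vecMulVec, Matrix.vecMulVec_mul, ← Matrix.mulVec_transpose, hA.eq]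
  rfl

lemma trace_mul_outer (A : Matrix (Fin p) (Fin p) ℝ) (u v : EuclideanSpace ℝ (Fin p)) :
    (A * outer u v).trace = inner ℝ v (applyMat A u) := by
  rw [outer, Matrix.mul_vecMulVec, Matrix.trace_vecMulVec, applyMat, Matrix.inner_toEuclideanCLM,
    dotProduct_comm]

lemma outer_applyMat (u v x : EuclideanSpace ℝ (Fin p)) :
    applyMat (outer u v) x = inner ℝ v x • u := by
  ext i
  simp [applyMat, outer, Matrix.vecMulVec_mulVec, EuclideanSpace.inner_eq_star_dotProduct,
    mul_comm, dotProduct_comm]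

lemma outer_isSymm (u : EuclideanSpace ℝ (Fin p)) : (outer u u).IsSymm := by
  rw [Matrix.IsSymm, outer, Matrix.transpose_vecMulVec]

end applyMat

section Frobenius

open scoped Matrix.Norms.Frobenius

variable {p : ℕ}

lemma norm_applyMat_le (A : Matrix (Fin p) (Fin p) ℝ) (v : EuclideanSpace ℝ (Fin p)) :
    ‖applyMat A v‖ ≤ ‖A‖ * ‖v‖ := by
  have h1 := Matrix.frobenius_norm_mul A (Matrix.replicateCol Unit v.ofLp)
  rwa [← Matrix.replicateCol_mulVec, Matrix.frobenius_norm_replicateCol,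
    Matrix.frobenius_norm_replicateCol] at h1

lemma norm_outer_le (u v : EuclideanSpace ℝ (Fin p)) : ‖outer u v‖ ≤ ‖u‖ * ‖v‖ := by
  have h1 := Matrix.frobenius_norm_mul (Matrix.replicateCol Unit u.ofLp)
    (Matrix.replicateRow Unit v.ofLp)
  rwa [← Matrix.vecMulVec_eq, Matrix.frobenius_norm_replicateCol,
    Matrix.frobenius_norm_replicateRow] at h1

lemma frobenius_norm_sq_eq_trace {A : Matrix (Fin p) (Fin p) ℝ} (hA : A.IsSymm) :
    ‖A‖ ^ 2 = (A * A).trace := by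
  have h0 : (0 : ℝ) ≤ ∑ i, ∑ j, ‖A i j‖ ^ (2 : ℝ) :=
    Finset.sum_nonneg fun i _ => Finset.sum_nonneg fun j _ => Real.rpow_nonneg (norm_nonneg _) _
  rw [Matrix.frobenius_norm_def, ← Real.sqrt_eq_rpow, Real.sq_sqrt h0, Matrix.trace]
  refine Finset.sum_congr rfl fun i _ => ?_
  rw [Matrix.diag_apply, Matrix.mul_apply]
  refine Finset.sum_congr rfl fun j _ => ?_
  rw [Real.rpow_two, Real.norm_eq_abs, sq_abs, sq, hA.apply]

/-! ### The BFGS update near the identity -/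

lemma bfgsUpdate_isSymm {B : Matrix (Fin p) (Fin p) ℝ} (hB : B.IsSymm)
    (s y : EuclideanSpace ℝ (Fin p)) : (bfgsUpdate B s y).IsSymm := by
  rw [bfgsUpdate, mul_outer_mul hB]
  exact (hB.add ((outer_isSymm y).smul _)).sub ((outer_isSymm _).smul _)

/-- The squared Frobenius distance to the identity after a BFGS update with `y = s`. -/
lemma norm_sq_bfgsUpdate_self_sub_one {C : Matrix (Fin p) (Fin p) ℝ} (hC : C.IsSymm)
    {s v : EuclideanSpace ℝ (Fin p)} (hv : v = applyMat C s) (hs : s ≠ 0)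
    (hb : inner ℝ s v ≠ 0) :
    ‖bfgsUpdate C s s - 1‖ ^ 2 = ‖C - 1‖ ^ 2 + (inner ℝ v v / inner ℝ s v) ^ 2 - 1
      - 2 * (inner ℝ v (applyMat C v) / inner ℝ s v) + 2 * (inner ℝ v v / inner ℝ s v) := by
  have hE : (C - 1).IsSymm := hC.sub Matrix.isSymm_one
  rw [frobenius_norm_sq_eq_trace ((bfgsUpdate_isSymm hC s s).sub Matrix.isSymm_one),
    frobenius_norm_sq_eq_trace hE]
  have hS : (inner ℝ s s : ℝ) ≠ 0 := inner_self_ne_zero.2 hs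
  have h1 : bfgsUpdate C s s - 1 = (C - 1) + (inner ℝ s s : ℝ)⁻¹ • outer s s -
      (inner ℝ s v : ℝ)⁻¹ • outer v v := by
    rw [bfgsUpdate, mul_outer_mul hC, ← hv]; abel
  have e1 : ((C - 1) * outer s s).trace = inner ℝ s v - inner ℝ s s := by
    rw [trace_mul_outer, sub_applyMat, one_applyMat, ← hv, inner_sub_right]
  have e2 : ((C - 1) * outer v v).trace = inner ℝ v (applyMat C v) - inner ℝ v v := by
    rw [trace_mul_outer, sub_applyMat, one_applyMat, inner_sub_right]
  have e3 : (outer s s * outer s s).trace = (inner ℝ s s : ℝ) ^ 2 := by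
    rw [trace_mul_outer, outer_applyMat, inner_smul_right, sq]
  have e4 : (outer v v * outer v v).trace = (inner ℝ v v : ℝ) ^ 2 := by
    rw [trace_mul_outer, outer_applyMat, inner_smul_right, sq]
  have e5 : (outer s s * outer v v).trace = (inner ℝ s v : ℝ) ^ 2 := by
    rw [trace_mul_outer, outer_applyMat, inner_smul_right, real_inner_comm s v, sq]
  rw [h1]
  simp only [sub_mul, add_mul, mul_sub, mul_add, Matrix.smul_mul, Matrix.mul_smul,
    Matrix.trace_sub, Matrix.trace_add, Matrix.trace_smul, smul_eq_mul, mul_one, one_mul]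
    at e1 e2 ⊢
  rw [Matrix.trace_mul_comm (outer s s) C, Matrix.trace_mul_comm (outer v v) C,
    Matrix.trace_mul_comm (outer v v) (outer s s), e3, e4, e5]
  rw [sub_eq_iff_eq_add] at e1 e2
  rw [e1, e2]
  field_simp
  ring

lemma abs_inner_applyMat_sub_le {C : Matrix (Fin p) (Fin p) ℝ} (v : EuclideanSpace ℝ (Fin p)) :
    |inner ℝ v (applyMat C v) - ‖v‖ ^ 2| ≤ ‖C - 1‖ * ‖v‖ ^ 2 := by
  have h1 : inner ℝ v (applyMat C v) - ‖v‖ ^ 2 = inner ℝ v (applyMat (C - 1) v) := by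
    rw [sub_applyMat, one_applyMat, inner_sub_right, real_inner_self_eq_norm_sq]
  rw [h1]
  calc _ ≤ ‖v‖ * ‖applyMat (C - 1) v‖ := abs_real_inner_le_norm _ _
    _ ≤ ‖v‖ * (‖C - 1‖ * ‖v‖) := by gcongr; exact norm_applyMat_le _ _
    _ = _ := by ring

/-- The BFGS update with `y = s` moves a matrix near the identity towards the identity, by an
amount that is quadratic in the error made by the matrix along `s`. -/
lemma norm_bfgsUpdate_self_sub_one_le {C : Matrix (Fin p) (Fin p) ℝ} (hC : C.IsSymm)
    (hC1 : ‖C - 1‖ ≤ 1 / 2) {s : EuclideanSpace ℝ (Fin p)} (hs : s ≠ 0) :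
    ‖bfgsUpdate C s s - 1‖ ≤ ‖C - 1‖ - (‖applyMat (C - 1) s‖ / ‖s‖) ^ 2 / 3 := by
  have hlow : ∀ v, 1 / 2 * ‖v‖ ^ 2 ≤ inner ℝ v (applyMat C v) := fun v => by
    have := (abs_le.1 (abs_inner_applyMat_sub_le (C := C) v)).1
    nlinarith [sq_nonneg ‖v‖]
  have hup := (abs_le.1 (abs_inner_applyMat_sub_le (C := C) s)).2
  have hspos : 0 < ‖s‖ := norm_pos_iff.2 hs
  set v := applyMat C s with hv
  set b : ℝ := inner ℝ s v with hb
  set N : ℝ := inner ℝ v v with hN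
  set w : ℝ := inner ℝ v (applyMat C v) with hw
  have hsC : inner ℝ s (applyMat C v) = N := by rw [← inner_applyMat_comm hC]
  have hvs : (inner ℝ v s : ℝ) = b := real_inner_comm _ _
  have hb0 : 0 < b := lt_of_lt_of_le (by positivity) (hlow s)
  have hbup : b ≤ 3 / 2 * ‖s‖ ^ 2 := by nlinarith [sq_nonneg ‖s‖]
  -- The Cauchy–Schwarz inequality for the inner product `⟪x, C y⟫`.
  have hCS : N ^ 2 ≤ b * w := by
    have h1 := hlow (b • v - N • s)
    have h2 : inner ℝ (b • v - N • s) (applyMat C (b • v - N • s)) = b * (b * w - N ^ 2) := by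
      simp only [applyMat_sub, applyMat_smul, inner_sub_left, inner_sub_right,
        real_inner_smul_left, real_inner_smul_right, ← hv, hsC, ← hb, ← hN, ← hw]
      ring
    rw [h2] at h1
    have h3 : 0 ≤ b * (b * w - N ^ 2) := le_trans (by positivity) h1
    linarith [nonneg_of_mul_nonneg_right h3 hb0]
  set d := applyMat (C - 1) s with hd
  have hdv : d = v - s := by rw [hd, sub_applyMat, one_applyMat]
  have hdd : 1 / 2 * ‖d‖ ^ 2 ≤ w - 2 * N + b := by
    have h2 : inner ℝ d (applyMat C d) = w - 2 * N + b := by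
      simp only [hdv, applyMat_sub, inner_sub_left, inner_sub_right, ← hv, hsC, ← hb, ← hN, ← hw]
      ring
    rw [← h2]; exact hlow d
  set θ := ‖d‖ / ‖s‖ with hθ
  have hθ0 : 0 ≤ θ := by positivity
  have hθd : θ * ‖s‖ = ‖d‖ := div_mul_cancel₀ _ hspos.ne'
  have hθc : θ ≤ ‖C - 1‖ := (div_le_iff₀ hspos).2 (norm_applyMat_le _ _)
  have hdec : θ ^ 2 / 3 * b ≤ w - 2 * N + b := by
    calc θ ^ 2 / 3 * b ≤ θ ^ 2 / 3 * (3 / 2 * ‖s‖ ^ 2) := by gcongr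
      _ = 1 / 2 * (θ * ‖s‖) ^ 2 := by ring
      _ ≤ _ := by rw [hθd]; exact hdd
  have hsq : ‖bfgsUpdate C s s - 1‖ ^ 2 ≤ ‖C - 1‖ ^ 2 - θ ^ 2 / 3 := by
    rw [norm_sq_bfgsUpdate_self_sub_one hC hv hs hb0.ne']
    have h1 : (N / b) ^ 2 ≤ w / b := by
      rw [div_pow, div_le_div_iff₀ (by positivity) hb0]
      nlinarith
    have h2 : θ ^ 2 / 3 ≤ w / b - 2 * (N / b) + 1 := by
      have h3 : w / b - 2 * (N / b) + 1 = (w - 2 * N + b) / b := by field_simp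
      rw [h3]; exact (le_div_iff₀ hb0).2 hdec
    linarith
  have h0 := norm_nonneg (C - 1)
  refine abs_le_of_sq_le_sq' (a := ‖bfgsUpdate C s s - 1‖) ?_ ?_ |>.2
  · nlinarith [sq_nonneg θ]
  · nlinarith [sq_nonneg θ]

/-- A relative error `σ` in the secant equation `y = s` changes the update by at most `7 σ`: the
numerator `y yᵀ` contributes `5 σ` and the denominator `⟪y, s⟫` contributes `2 σ`. -/
lemma norm_bfgsUpdate_sub_bfgsUpdate_self_le (C : Matrix (Fin p) (Fin p) ℝ)
    {s y : EuclideanSpace ℝ (Fin p)} (hs : s ≠ 0) {σ : ℝ} (hσ : σ ≤ 1 / 2)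
    (hy : ‖y - s‖ ≤ σ * ‖s‖) : ‖bfgsUpdate C s y - bfgsUpdate C s s‖ ≤ 7 * σ := by
  have hspos : 0 < ‖s‖ := norm_pos_iff.2 hs
  have hσ0 : 0 ≤ σ := nonneg_of_mul_nonneg_left ((norm_nonneg _).trans hy) hspos
  have hdiff : (inner ℝ y s : ℝ) - ‖s‖ ^ 2 = inner ℝ (y - s) s := by
    rw [inner_sub_left, real_inner_self_eq_norm_sq]
  have habs : |(inner ℝ y s : ℝ) - ‖s‖ ^ 2| ≤ σ * ‖s‖ ^ 2 := by
    rw [hdiff]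
    calc _ ≤ ‖y - s‖ * ‖s‖ := abs_real_inner_le_norm _ _
      _ ≤ σ * ‖s‖ * ‖s‖ := by gcongr
      _ = _ := by ring
  have hys : ‖s‖ ^ 2 / 2 ≤ inner ℝ y s := by
    nlinarith [(abs_le.1 habs).1, sq_nonneg ‖s‖]
  have hyspos : 0 < (inner ℝ y s : ℝ) := lt_of_lt_of_le (by positivity) hys
  have hynorm : ‖y‖ ≤ 3 / 2 * ‖s‖ := by
    have := norm_le_norm_add_norm_sub' y s
    nlinarith
  have h1 : bfgsUpdate C s y - bfgsUpdate C s s =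
      (inner ℝ y s : ℝ)⁻¹ • (outer (y - s) y + outer s (y - s)) +
        ((inner ℝ y s : ℝ)⁻¹ - (‖s‖ ^ 2)⁻¹) • outer s s := by
    have h2 : outer (y - s) y + outer s (y - s) = outer y y - outer s s := by
      simp only [outer, WithLp.ofLp_sub, Matrix.sub_vecMulVec, Matrix.vecMulVec_sub]
      abel
    rw [h2, bfgsUpdate, bfgsUpdate, real_inner_self_eq_norm_sq s, smul_sub, sub_smul]
    abel
  have hinv : ‖(inner ℝ y s : ℝ)⁻¹‖ ≤ 2 / ‖s‖ ^ 2 := by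
    rw [norm_inv, Real.norm_of_nonneg hyspos.le, inv_eq_one_div,
      div_le_div_iff₀ hyspos (by positivity)]
    linarith
  have hA : ‖outer (y - s) y + outer s (y - s)‖ ≤ 5 / 2 * σ * ‖s‖ ^ 2 := by
    calc _ ≤ ‖y - s‖ * ‖y‖ + ‖s‖ * ‖y - s‖ :=
          (norm_add_le _ _).trans (add_le_add (norm_outer_le _ _) (norm_outer_le _ _))
      _ ≤ (σ * ‖s‖) * (3 / 2 * ‖s‖) + ‖s‖ * (σ * ‖s‖) := by gcongr
      _ = _ := by ring
  have hB : ‖(inner ℝ y s : ℝ)⁻¹ - (‖s‖ ^ 2)⁻¹‖ ≤ 2 / ‖s‖ ^ 2 * σ := by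
    have : (inner ℝ y s : ℝ)⁻¹ - (‖s‖ ^ 2)⁻¹ =
        (inner ℝ y s : ℝ)⁻¹ * ((‖s‖ ^ 2 - inner ℝ y s) * (‖s‖ ^ 2)⁻¹) := by
      field_simp
    rw [this, norm_mul]
    gcongr
    rw [norm_mul, norm_inv, norm_pow, norm_norm, Real.norm_eq_abs, abs_sub_comm,
      ← div_eq_mul_inv]
    exact div_le_of_le_mul₀ (by positivity) hσ0 habs
  rw [h1]
  calc _ ≤ 2 / ‖s‖ ^ 2 * (5 / 2 * σ * ‖s‖ ^ 2) + 2 / ‖s‖ ^ 2 * σ * (‖s‖ * ‖s‖) := by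
        refine (norm_add_le _ _).trans ?_
        rw [norm_smul, norm_smul]
        gcongr
        exact norm_outer_le _ _
    _ = 7 * σ := by field_simp; ring

/-! ### The BFGS update in the metric of a positive definite matrix -/

/-- A change of variables by a symmetric matrix commutes with the BFGS update. -/
lemma bfgsUpdate_conj {M S : Matrix (Fin p) (Fin p) ℝ} (hM : M.IsSymm) (hMS : M * S = 1)
    {B : Matrix (Fin p) (Fin p) ℝ} (s y : EuclideanSpace ℝ (Fin p)) :
    bfgsUpdate (M * B * M) (applyMat S s) (applyMat M y) = M * bfgsUpdate B s y * M := by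
  have hs : applyMat M (applyMat S s) = s := by rw [← mul_applyMat, hMS, one_applyMat]
  have h1 : (inner ℝ (applyMat M y) (applyMat S s) : ℝ) = inner ℝ y s := by
    rw [inner_applyMat_comm hM, hs]
  have h2 : (inner ℝ (applyMat S s) (applyMat (M * B * M) (applyMat S s)) : ℝ) =
      inner ℝ s (applyMat B s) := by
    rw [mul_applyMat, mul_applyMat, hs, ← inner_applyMat_comm hM, hs]
  have h3 : M * B * M * outer (applyMat S s) (applyMat S s) * (M * B * M) =
      M * (B * outer s s * B) * M := by
    have := mul_outer_mul hM (applyMat S s) (applyMat S s)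
    rw [hs] at this
    rw [← this]
    simp only [mul_assoc]
  rw [bfgsUpdate, bfgsUpdate, h1, h2, h3, ← mul_outer_mul hM]
  simp only [mul_add, mul_sub, add_mul, sub_mul, Matrix.mul_smul, Matrix.smul_mul]

/-- Bounded deterioration of the BFGS update in the metric of `H = S²`, where `M = S⁻¹`: the
weighted error grows at most by a multiple of the relative error of the secant equation `y ≈ H s`,
and it decreases by an amount that is quadratic in the error of `B` along `s`. -/
lemma weightedNorm_bfgsUpdate_sub_le {M S H B : Matrix (Fin p) (Fin p) ℝ} (hM : M.IsSymm)
    (hMS : M * S = 1) (hSM : S * M = 1) (hH : H = S * S) (hB : B.IsSymm)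
    (hBH : weightedNorm M (B - H) ≤ 1 / 2) {s y : EuclideanSpace ℝ (Fin p)} (hs : s ≠ 0)
    {σ : ℝ} (hσ : σ ≤ 1 / 2) (hy : ‖applyMat M (y - applyMat H s)‖ ≤ σ * ‖applyMat S s‖) :
    weightedNorm M (bfgsUpdate B s y - H) ≤ weightedNorm M (B - H) -
      (‖applyMat M (applyMat (B - H) s)‖ / ‖applyMat S s‖) ^ 2 / 3 + 7 * σ := by
  have hw : ∀ A, weightedNorm M (A - H) = ‖M * A * M - 1‖ := fun A => by
    have h2 : M * (S * S) * M = 1 := by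
      calc M * (S * S) * M = (M * S) * (S * M) := by simp only [mul_assoc]
        _ = 1 := by rw [hMS, hSM, mul_one]
    rw [weightedNorm, hH, mul_sub, sub_mul, h2]
  have hs' : applyMat M (applyMat S s) = s := by rw [← mul_applyMat, hMS, one_applyMat]
  have hSs : applyMat S s ≠ 0 := fun h => hs (by rw [← hs', h, applyMat_zero])
  have hC : (M * B * M).IsSymm := by
    rw [Matrix.IsSymm, Matrix.transpose_mul, Matrix.transpose_mul, hM.eq, hB.eq, mul_assoc]
  have hMH : applyMat M (applyMat H s) = applyMat S s := by
    rw [← mul_applyMat, hH, ← mul_assoc, hMS, one_mul]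
  have he : applyMat (M * B * M - 1) (applyMat S s) = applyMat M (applyMat (B - H) s) := by
    rw [sub_applyMat, one_applyMat, mul_applyMat, mul_applyMat, hs', sub_applyMat, applyMat_sub,
      hMH]
  rw [hw] at hBH
  rw [hw, hw, ← bfgsUpdate_conj hM hMS]
  have h1 := norm_bfgsUpdate_self_sub_one_le hC hBH hSs
  rw [he] at h1
  have h2 := norm_bfgsUpdate_sub_bfgsUpdate_self_le (M * B * M) (y := applyMat M y) hSs hσ
    (by rwa [applyMat_sub, hMH] at hy)
  have h3 := norm_sub_le_norm_sub_add_norm_sub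
    (bfgsUpdate (M * B * M) (applyMat S s) (applyMat M y))
    (bfgsUpdate (M * B * M) (applyMat S s) (applyMat S s)) 1
  linarith

end Frobenius

/-! ### Gradients and Hessians -/

section Hessian

variable {p : ℕ} {g : EuclideanSpace ℝ (Fin p) → ℝ}

lemma differentiable_gradient (hg : ContDiff ℝ 2 g) : Differentiable ℝ (gradient g) :=
  (InnerProductSpace.toDual ℝ (EuclideanSpace ℝ (Fin p))).symm.differentiable.comp
    ((hg.fderiv_right (m := 1) (by norm_num)).differentiable (by norm_num))

lemma applyMat_hessian (x v : EuclideanSpace ℝ (Fin p)) :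
    applyMat (hessian g x) v = fderiv ℝ (gradient g) x v := by
  simp [applyMat, hessian]

lemma specNorm_hessian_sub (x y : EuclideanSpace ℝ (Fin p)) :
    specNorm (hessian g x - hessian g y) =
      ‖fderiv ℝ (gradient g) x - fderiv ℝ (gradient g) y‖ := by
  simp [specNorm, hessian]

lemma inner_applyMat_hessian (hg : ContDiff ℝ 2 g) (x u v : EuclideanSpace ℝ (Fin p)) :
    inner ℝ (applyMat (hessian g x) u) v = fderiv ℝ (fderiv ℝ g) x u v := by
  have h1 : HasFDerivAt (fderiv ℝ g) (fderiv ℝ (fderiv ℝ g) x) x :=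
    ((hg.fderiv_right (m := 1) (by norm_num)).differentiable (by norm_num) x).hasFDerivAt
  have h2 : HasFDerivAt (fun z => fderiv ℝ g z v) ((fderiv ℝ (fderiv ℝ g) x).flip v) x :=
    ((ContinuousLinearMap.apply ℝ ℝ v).hasFDerivAt.comp x h1).congr_fderiv (by ext; simp)
  have h3 : HasFDerivAt (fun z => inner ℝ (gradient g z) v)
      ((innerSL ℝ v).comp (fderiv ℝ (gradient g) x)) x := by
    refine ((innerSL ℝ v).hasFDerivAt.comp x
      (differentiable_gradient hg x).hasFDerivAt).congr_of_eventuallyEq ?_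
    exact Eventually.of_forall fun z => by simp
  have h4 : (fun z => inner ℝ (gradient g z) v) = fun z => fderiv ℝ g z v :=
    funext fun z => inner_gradient_left
  rw [h4] at h3
  have h5 := congrArg (fun T => T u) (h3.unique h2)
  simpa [applyMat_hessian, real_inner_comm] using h5

lemma hessian_isSymm (hg : ContDiff ℝ 2 g) (x : EuclideanSpace ℝ (Fin p)) :
    (hessian g x).IsSymm := by
  have hsymm : IsSymmSndFDerivAt ℝ g x :=
    hg.contDiffAt.isSymmSndFDerivAt (by simp)
  ext i j
  have key : ∀ i j : Fin p, inner ℝ (applyMat (hessian g x) (EuclideanSpace.single i 1))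
      (EuclideanSpace.single j 1) = hessian g x j i := fun i j => by
    rw [real_inner_comm, applyMat, Matrix.inner_toEuclideanCLM]
    simp
  rw [Matrix.transpose_apply, ← key, ← key, inner_applyMat_hessian hg, inner_applyMat_hessian hg]
  exact hsymm _ _

/-- The secant error of a gradient difference, for two points in the ball of radius `R` around `x`
and the Hessian at `x`. -/
lemma norm_gradient_sub_sub_le (hg : ContDiff ℝ 2 g) {Lt : ℝ} (hLt : 0 ≤ Lt)
    (hhess : ∀ x y, specNorm (hessian g x - hessian g y) ≤ Lt * ‖x - y‖)
    {x z z' : EuclideanSpace ℝ (Fin p)} {R : ℝ} (hz : ‖z - x‖ ≤ R) (hz' : ‖z' - x‖ ≤ R) :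
    ‖gradient g z' - gradient g z - applyMat (hessian g x) (z' - z)‖ ≤ Lt * R * ‖z' - z‖ := by
  rw [applyMat_hessian]
  refine (convex_closedBall x R).norm_image_sub_le_of_norm_fderiv_le'
    (fun w _ => differentiable_gradient hg w) (fun w hw => ?_)
    (mem_closedBall_iff_norm.2 hz) (mem_closedBall_iff_norm.2 hz')
  rw [← specNorm_hessian_sub]
  exact (hhess w x).trans (mul_le_mul_of_nonneg_left (mem_closedBall_iff_norm.1 hw) hLt)

lemma abs_inner_gradient_sub_sub_le (hg : ContDiff ℝ 2 g) {Lt : ℝ} (hLt : 0 ≤ Lt)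
    (hhess : ∀ x y, specNorm (hessian g x - hessian g y) ≤ Lt * ‖x - y‖)
    (x v : EuclideanSpace ℝ (Fin p)) :
    |inner ℝ (gradient g (x + v) - gradient g x) v - inner ℝ v (applyMat (hessian g x) v)| ≤
      Lt * ‖v‖ ^ 3 := by
  have h := norm_gradient_sub_sub_le hg hLt hhess (x := x) (z := x) (z' := x + v) (R := ‖v‖)
    (by simp) (by simp)
  rw [add_sub_cancel_left] at h
  rw [← real_inner_comm v (applyMat _ v), ← inner_sub_left]
  calc _ ≤ _ := abs_real_inner_le_norm _ _
    _ ≤ Lt * ‖v‖ * ‖v‖ * ‖v‖ := by gcongr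
    _ = _ := by ring

/-- Strong monotonicity and the upper bound on the gradient differences pass to the Hessian. -/
lemma inner_hessian_bounds (hg : ContDiff ℝ 2 g) {μ L Lt : ℝ} (hLt : 0 ≤ Lt)
    (hgrad : ∀ x y, μ * ‖x - y‖ ^ 2 ≤ inner ℝ (gradient g x - gradient g y) (x - y) ∧
      inner ℝ (gradient g x - gradient g y) (x - y) ≤ L * ‖x - y‖ ^ 2)
    (hhess : ∀ x y, specNorm (hessian g x - hessian g y) ≤ Lt * ‖x - y‖)
    (x v : EuclideanSpace ℝ (Fin p)) :
    μ * ‖v‖ ^ 2 ≤ inner ℝ v (applyMat (hessian g x) v) ∧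
      inner ℝ v (applyMat (hessian g x) v) ≤ L * ‖v‖ ^ 2 := by
  set q : ℝ := inner ℝ v (applyMat (hessian g x) v) with hq
  -- Dividing the inequalities along the step `t • v` by `t ^ 2` leaves an error of order `t`.
  have key : ∀ t : ℝ, 0 < t → μ * ‖v‖ ^ 2 ≤ q + t * (Lt * ‖v‖ ^ 3) ∧
      q ≤ L * ‖v‖ ^ 2 + t * (Lt * ‖v‖ ^ 3) := fun t ht => by
    have h1 := abs_le.1 (abs_inner_gradient_sub_sub_le hg hLt hhess x (t • v))
    have h2 := hgrad (x + t • v) x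
    rw [add_sub_cancel_left] at h2
    rw [applyMat_smul, real_inner_smul_left, real_inner_smul_right v _ t, ← hq] at h1
    rw [norm_smul, Real.norm_of_nonneg ht.le] at h1 h2
    have ht2 : 0 < t ^ 2 := by positivity
    constructor
    · refine le_of_mul_le_mul_left ?_ ht2
      nlinarith [h1.2, h2.1]
    · refine le_of_mul_le_mul_left ?_ ht2
      nlinarith [h1.1, h2.2]
  set K := Lt * ‖v‖ ^ 3 with hK
  have hK0 : 0 ≤ K := by positivity
  have small : ∀ a b : ℝ, (∀ t : ℝ, 0 < t → a ≤ b + t * K) → a ≤ b := fun a b h => by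
    refine le_of_forall_pos_le_add fun η hη => ?_
    refine (h (η / (K + 1)) (by positivity)).trans ?_
    have : η / (K + 1) * K ≤ η := by
      rw [div_mul_eq_mul_div, div_le_iff₀ (by positivity)]
      nlinarith
    linarith
  exact ⟨small _ _ fun t ht => (key t ht).1, small _ _ fun t ht => (key t ht).2⟩

end Hessian

/-! ### The metric of a positive definite matrix -/

section Metric

variable {p : ℕ} {H : Matrix (Fin p) (Fin p) ℝ} {μ L : ℝ}

lemma posDef_of_inner_lower_bound (hH : H.IsSymm) (hμ : 0 < μ)
    (h : ∀ v, μ * ‖v‖ ^ 2 ≤ inner ℝ v (applyMat H v)) : H.PosDef := by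
  refine Matrix.PosDef.of_dotProduct_mulVec_pos
    (by rwa [Matrix.IsHermitian, Matrix.conjTranspose_eq_transpose_of_trivial]) fun x hx => ?_
  have h1 := h (WithLp.toLp 2 x)
  rw [applyMat, Matrix.inner_toEuclideanCLM] at h1
  have h2 : 0 < ‖WithLp.toLp 2 x‖ := norm_pos_iff.2 (by simpa using hx)
  rw [star_trivial]
  exact lt_of_lt_of_le (by positivity) h1

open scoped MatrixOrder in
/-- The matrix `S` is the positive square root of `H`. -/
lemma exists_sqrt_of_posDef (hH : H.PosDef) :
    ∃ S : Matrix (Fin p) (Fin p) ℝ, S.IsSymm ∧ (invSqrt H).IsSymm ∧ invSqrt H * S = 1 ∧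
      S * invSqrt H = 1 ∧ H = S * S := by
  have hS : (CFC.sqrt H).IsSymm := by
    have := (Matrix.nonneg_iff_posSemidef.1 (CFC.sqrt_nonneg H)).isHermitian
    rwa [Matrix.IsHermitian, Matrix.conjTranspose_eq_transpose_of_trivial] at this
  have hSS : CFC.sqrt H * CFC.sqrt H = H := CFC.sqrt_mul_sqrt_self H hH.posSemidef.nonneg
  have hunit : IsUnit (CFC.sqrt H).det := by
    have h1 := hH.det_pos
    rw [← hSS, Matrix.det_mul] at h1
    exact (left_ne_zero_of_mul h1.ne').isUnit
  refine ⟨CFC.sqrt H, hS, ?_, Matrix.nonsing_inv_mul _ hunit, Matrix.mul_nonsing_inv _ hunit,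
    hSS.symm⟩
  rw [invSqrt, Matrix.IsSymm, Matrix.transpose_nonsing_inv, hS.eq]

lemma weightedNorm_nonneg (M A : Matrix (Fin p) (Fin p) ℝ) : 0 ≤ weightedNorm M A := by
  open scoped Matrix.Norms.Frobenius in exact norm_nonneg (M * A * M)

lemma norm_applyMat_sqrt_sq {S : Matrix (Fin p) (Fin p) ℝ} (hS : S.IsSymm) (hSS : H = S * S)
    (v : EuclideanSpace ℝ (Fin p)) : ‖applyMat S v‖ ^ 2 = inner ℝ v (applyMat H v) := by
  rw [hSS, mul_applyMat, ← inner_applyMat_comm hS, real_inner_self_eq_norm_sq]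

open scoped Matrix.Norms.Frobenius in
lemma norm_invSqrt_conj_le {M S A : Matrix (Fin p) (Fin p) ℝ} (hMS : M * S = 1)
    (v : EuclideanSpace ℝ (Fin p)) :
    ‖applyMat M (applyMat A v)‖ ≤ weightedNorm M A * ‖applyMat S v‖ := by
  have h1 : applyMat M (applyMat A v) = applyMat (M * A * M) (applyMat S v) := by
    rw [mul_applyMat, mul_applyMat, ← mul_applyMat M S, hMS, one_applyMat]
  rw [h1]
  exact norm_applyMat_le _ _

lemma abs_inner_applyMat_le_weightedNorm (hH : H.IsSymm) (hμ : 0 < μ)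
    (hlow : ∀ v, μ * ‖v‖ ^ 2 ≤ inner ℝ v (applyMat H v)) (A : Matrix (Fin p) (Fin p) ℝ)
    (v : EuclideanSpace ℝ (Fin p)) :
    |inner ℝ v (applyMat A v)| ≤ weightedNorm (invSqrt H) A * inner ℝ v (applyMat H v) := by
  obtain ⟨S, hS, -, hMS, hSM, hSS⟩ :=
    exists_sqrt_of_posDef (posDef_of_inner_lower_bound hH hμ hlow)
  set M := invSqrt H
  have h1 : inner ℝ v (applyMat A v) =
      inner ℝ (applyMat S v) (applyMat M (applyMat A v)) := by
    rw [inner_applyMat_comm hS, ← mul_applyMat S M, hSM, one_applyMat]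
  rw [h1, ← norm_applyMat_sqrt_sq hS hSS]
  calc _ ≤ _ := abs_real_inner_le_norm _ _
    _ ≤ ‖applyMat S v‖ * (weightedNorm M A * ‖applyMat S v‖) := by
      gcongr; exact norm_invSqrt_conj_le hMS v
    _ = _ := by ring

lemma sqrt_mul_norm_le_norm_applyMat {S : Matrix (Fin p) (Fin p) ℝ} (hS : S.IsSymm)
    (hSS : H = S * S) (hμ : 0 ≤ μ) (hlow : ∀ v, μ * ‖v‖ ^ 2 ≤ inner ℝ v (applyMat H v))
    (v : EuclideanSpace ℝ (Fin p)) : √μ * ‖v‖ ≤ ‖applyMat S v‖ := by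
  refine le_of_sq_le_sq ?_ (norm_nonneg _)
  rw [mul_pow, Real.sq_sqrt hμ, norm_applyMat_sqrt_sq hS hSS]
  exact hlow v

lemma norm_applyMat_le_sqrt_mul_norm {S : Matrix (Fin p) (Fin p) ℝ} (hS : S.IsSymm)
    (hSS : H = S * S) (hL : 0 ≤ L) (hup : ∀ v, inner ℝ v (applyMat H v) ≤ L * ‖v‖ ^ 2)
    (v : EuclideanSpace ℝ (Fin p)) : ‖applyMat S v‖ ≤ √L * ‖v‖ := by
  refine le_of_sq_le_sq ?_ (by positivity)
  rw [mul_pow, Real.sq_sqrt hL, norm_applyMat_sqrt_sq hS hSS]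
  exact hup v

lemma norm_applyMat_le_weightedNorm (hH : H.IsSymm) (hμ : 0 < μ) (hL : 0 ≤ L)
    (hlow : ∀ v, μ * ‖v‖ ^ 2 ≤ inner ℝ v (applyMat H v))
    (hup : ∀ v, inner ℝ v (applyMat H v) ≤ L * ‖v‖ ^ 2) (A : Matrix (Fin p) (Fin p) ℝ)
    (v : EuclideanSpace ℝ (Fin p)) :
    ‖applyMat A v‖ ≤ L * weightedNorm (invSqrt H) A * ‖v‖ := by
  obtain ⟨S, hS, -, hMS, hSM, hSS⟩ :=
    exists_sqrt_of_posDef (posDef_of_inner_lower_bound hH hμ hlow)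
  set M := invSqrt H
  have hw := weightedNorm_nonneg M A
  calc ‖applyMat A v‖ = ‖applyMat S (applyMat M (applyMat A v))‖ := by
        rw [← mul_applyMat S M, hSM, one_applyMat]
    _ ≤ √L * ‖applyMat M (applyMat A v)‖ := norm_applyMat_le_sqrt_mul_norm hS hSS hL hup _
    _ ≤ √L * (weightedNorm M A * (√L * ‖v‖)) := by
        gcongr
        refine (norm_invSqrt_conj_le hMS v).trans ?_
        gcongr
        exact norm_applyMat_le_sqrt_mul_norm hS hSS hL hup _
    _ = √L ^ 2 * weightedNorm M A * ‖v‖ := by ring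
    _ = _ := by rw [Real.sq_sqrt hL]

/-- One BFGS update of `B` for a function `g`, with both points in the ball of radius `R` around
`x`. The number `θ` measures the error of `B` as an approximation of the Hessian along the step. -/
lemma exists_weightedNorm_bfgsUpdate_le {g : EuclideanSpace ℝ (Fin p) → ℝ}
    (hg : ContDiff ℝ 2 g) {Lt : ℝ} (hLt : 0 ≤ Lt) (hμ : 0 < μ) (hL : 0 ≤ L)
    {x : EuclideanSpace ℝ (Fin p)} (hx : H = hessian g x)
    (hlow : ∀ v, μ * ‖v‖ ^ 2 ≤ inner ℝ v (applyMat H v))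
    (hup : ∀ v, inner ℝ v (applyMat H v) ≤ L * ‖v‖ ^ 2)
    (hhess : ∀ x y, specNorm (hessian g x - hessian g y) ≤ Lt * ‖x - y‖)
    {B : Matrix (Fin p) (Fin p) ℝ} (hB : B.IsSymm)
    (hBH : weightedNorm (invSqrt H) (B - H) ≤ 1 / 2)
    {z z' : EuclideanSpace ℝ (Fin p)} {R : ℝ} (hz : ‖z - x‖ ≤ R) (hz' : ‖z' - x‖ ≤ R)
    (hR : Lt * R / μ ≤ 1 / 2) :
    ∃ θ : ℝ, 0 ≤ θ ∧
      weightedNorm (invSqrt H) (bfgsUpdate B (z' - z) (gradient g z' - gradient g z) - H) ≤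
        weightedNorm (invSqrt H) (B - H) - θ ^ 2 / 3 + 7 * (Lt * R / μ) ∧
      ‖applyMat (B - H) (z' - z)‖ ≤ L * θ * ‖z' - z‖ := by
  have hR0 : 0 ≤ R := (norm_nonneg _).trans hz
  rcases eq_or_ne z' z with rfl | hne
  · refine ⟨0, le_rfl, ?_, by simp [applyMat_zero]⟩
    have : bfgsUpdate B (z' - z') (gradient g z' - gradient g z') = B := by
      simp [bfgsUpdate, outer]
    rw [this]
    have : 0 ≤ 7 * (Lt * R / μ) := by positivity
    linarith
  set s := z' - z with hs
  have hs0 : s ≠ 0 := sub_ne_zero.2 hne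
  have hH : H.IsSymm := hx ▸ hessian_isSymm hg x
  obtain ⟨S, hS, hM, hMS, hSM, hSS⟩ :=
    exists_sqrt_of_posDef (posDef_of_inner_lower_bound hH hμ hlow)
  set M := invSqrt H
  have hsecant := norm_gradient_sub_sub_le hg hLt hhess hz hz'
  rw [← hx, ← hs] at hsecant
  have hSs : √μ * ‖s‖ ≤ ‖applyMat S s‖ := sqrt_mul_norm_le_norm_applyMat hS hSS hμ.le hlow s
  have hSspos : 0 < ‖applyMat S s‖ :=
    lt_of_lt_of_le (mul_pos (Real.sqrt_pos.2 hμ) (norm_pos_iff.2 hs0)) hSs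
  have hMy : ‖applyMat M (gradient g z' - gradient g z - applyMat H s)‖ ≤
      Lt * R / μ * ‖applyMat S s‖ := by
    set d := gradient g z' - gradient g z - applyMat H s
    have h1 : √μ * ‖applyMat M d‖ ≤ ‖d‖ := by
      have := sqrt_mul_norm_le_norm_applyMat hS hSS hμ.le hlow (applyMat M d)
      rwa [← mul_applyMat S M, hSM, one_applyMat] at this
    have h2 : μ * ‖applyMat M d‖ ≤ Lt * R * ‖applyMat S s‖ := by
      calc μ * ‖applyMat M d‖ = √μ * (√μ * ‖applyMat M d‖) := by
            rw [← mul_assoc, Real.mul_self_sqrt hμ.le]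
        _ ≤ √μ * (Lt * R * ‖s‖) :=
            mul_le_mul_of_nonneg_left (h1.trans hsecant) (Real.sqrt_nonneg μ)
        _ = Lt * R * (√μ * ‖s‖) := by ring
        _ ≤ _ := by gcongr
    rw [div_mul_eq_mul_div, le_div_iff₀ hμ]
    linarith
  refine ⟨‖applyMat M (applyMat (B - H) s)‖ / ‖applyMat S s‖, by positivity,
    weightedNorm_bfgsUpdate_sub_le hM hMS hSM hSS hB hBH hs0 hR hMy, ?_⟩
  set θ := ‖applyMat M (applyMat (B - H) s)‖ / ‖applyMat S s‖ with hθ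
  have hθS : ‖applyMat M (applyMat (B - H) s)‖ = θ * ‖applyMat S s‖ :=
    (div_mul_cancel₀ _ hSspos.ne').symm
  calc ‖applyMat (B - H) s‖ = ‖applyMat S (applyMat M (applyMat (B - H) s))‖ := by
        rw [← mul_applyMat S M, hSM, one_applyMat]
    _ ≤ √L * ‖applyMat M (applyMat (B - H) s)‖ := norm_applyMat_le_sqrt_mul_norm hS hSS hL hup _
    _ ≤ √L * (θ * (√L * ‖s‖)) := by
        rw [hθS]
        gcongr
        exact norm_applyMat_le_sqrt_mul_norm hS hSS hL hup _
    _ = √L ^ 2 * θ * ‖s‖ := by ring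
    _ = _ := by rw [Real.sq_sqrt hL]

end Metric

/-! ### The cyclic order of the IQN updates -/

section Cyclic

lemma exists_mod_eq {n i : ℕ} (hi : i < n) (t : ℕ) : ∃ u, t ≤ u ∧ u < t + n ∧ u % n = i := by
  induction t with
  | zero => exact ⟨i, by omega, by omega, Nat.mod_eq_of_lt hi⟩
  | succ t ih =>
    obtain ⟨u, h1, h2, h3⟩ := ih
    rcases h1.eq_or_lt with rfl | h
    · exact ⟨t + n, by omega, by omega, by rwa [Nat.add_mod_right]⟩
    · exact ⟨u, by omega, by omega, h3⟩

variable {n p : ℕ} (f : Fin n → EuclideanSpace ℝ (Fin p) → ℝ) (x₀ : EuclideanSpace ℝ (Fin p))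
  (B₀ : Fin n → Matrix (Fin p) (Fin p) ℝ)

lemma iqn_succ_of_eq {t : ℕ} {i : Fin n} (h : (i : ℕ) = t % n) :
    (iqn f x₀ B₀ (t + 1)).z i = (iqn f x₀ B₀ (t + 1)).x ∧
      (iqn f x₀ B₀ (t + 1)).B i = bfgsUpdate ((iqn f x₀ B₀ t).B i)
        ((iqn f x₀ B₀ (t + 1)).x - (iqn f x₀ B₀ t).z i)
        (gradient (f i) (iqn f x₀ B₀ (t + 1)).x - gradient (f i) ((iqn f x₀ B₀ t).z i)) :=
  ⟨if_pos h, if_pos h⟩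

lemma iqn_succ_of_ne {t : ℕ} {i : Fin n} (h : (i : ℕ) ≠ t % n) :
    (iqn f x₀ B₀ (t + 1)).z i = (iqn f x₀ B₀ t).z i ∧
      (iqn f x₀ B₀ (t + 1)).B i = (iqn f x₀ B₀ t).B i :=
  ⟨if_neg h, if_neg h⟩

/-- The information on function `i` stays the same until the next update of this function. -/
lemma exists_next_update (t : ℕ) (i : Fin n) :
    ∃ u, t ≤ u ∧ u < t + n ∧ (i : ℕ) = u % n ∧
      (iqn f x₀ B₀ u).z i = (iqn f x₀ B₀ t).z i ∧ (iqn f x₀ B₀ u).B i = (iqn f x₀ B₀ t).B i := by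
  have hex : ∃ d, (t + d) % n = i := by
    obtain ⟨u, h1, -, h3⟩ := exists_mod_eq i.2 t
    exact ⟨u - t, by rwa [Nat.add_sub_cancel' h1]⟩
  have hlt : Nat.find hex < n := by
    obtain ⟨u, h1, h2, h3⟩ := exists_mod_eq i.2 t
    have := Nat.find_min' hex (m := u - t) (by rwa [Nat.add_sub_cancel' h1])
    omega
  have hstay : ∀ d ≤ Nat.find hex, (iqn f x₀ B₀ (t + d)).z i = (iqn f x₀ B₀ t).z i ∧
      (iqn f x₀ B₀ (t + d)).B i = (iqn f x₀ B₀ t).B i := by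
    intro d hd
    induction d with
    | zero => exact ⟨rfl, rfl⟩
    | succ d ih =>
      have h1 := iqn_succ_of_ne f x₀ B₀ (t := t + d) (i := i)
        (Ne.symm (Nat.find_min hex (Nat.lt_of_succ_le hd)))
      have h2 := ih (by omega)
      exact ⟨h1.1.trans h2.1, h1.2.trans h2.2⟩
  exact ⟨t + Nat.find hex, by omega, by omega, (Nat.find_spec hex).symm, hstay _ le_rfl⟩

/-- The copies of the variable are the last `n` iterates, or the starting point. -/
lemma exists_z_eq_iterate (t : ℕ) (i : Fin n) :
    ∃ τ, τ ≤ t ∧ t < τ + n ∧ (iqn f x₀ B₀ t).z i = (iqn f x₀ B₀ τ).x := by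
  suffices h : ∃ τ, τ ≤ t ∧ (∀ u, τ ≤ u → u < t → u % n ≠ i) ∧
      (iqn f x₀ B₀ t).z i = (iqn f x₀ B₀ τ).x by
    obtain ⟨τ, h1, h2, h3⟩ := h
    obtain ⟨u, h4, h5, h6⟩ := exists_mod_eq i.2 τ
    refine ⟨τ, h1, ?_, h3⟩
    by_contra hlt
    exact h2 u h4 (by omega) h6
  induction t with
  | zero => exact ⟨0, le_rfl, fun u _ h => absurd h (Nat.not_lt_zero u), rfl⟩
  | succ t ih =>
    by_cases h : (i : ℕ) = t % n
    · exact ⟨t + 1, le_rfl, fun u h1 h2 => by omega, (iqn_succ_of_eq f x₀ B₀ h).1⟩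
    · obtain ⟨τ, h1, h2, h3⟩ := ih
      refine ⟨τ, by omega, fun u h4 h5 => ?_, (iqn_succ_of_ne f x₀ B₀ h).1.trans h3⟩
      rcases (Nat.lt_succ_iff.1 h5).eq_or_lt with rfl | h6
      · exact Ne.symm h
      · exact h2 u h4 h6

end Cyclic

/-! ### Local estimates for IQN -/

/-- What the local analysis of IQN uses about the functions `f i` near the minimizer `xstar` of
their sum: Hessians that are Lipschitz continuous with constant `Lt` and lie between `μ` and `L`
at `xstar`, and gradients that sum to zero there. -/
structure IsIQNProblem {n p : ℕ} (f : Fin n → EuclideanSpace ℝ (Fin p) → ℝ)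
    (xstar : EuclideanSpace ℝ (Fin p)) (μ L Lt : ℝ) : Prop where
  contDiff : ∀ i, ContDiff ℝ 2 (f i)
  hμ : 0 < μ
  hL : 0 < L
  hLt : 0 < Lt
  lower : ∀ i v, μ * ‖v‖ ^ 2 ≤ inner ℝ v (applyMat (hessian (f i) xstar) v)
  upper : ∀ i v, inner ℝ v (applyMat (hessian (f i) xstar) v) ≤ L * ‖v‖ ^ 2
  hess_lipschitz : ∀ i x y, specNorm (hessian (f i) x - hessian (f i) y) ≤ Lt * ‖x - y‖
  sum_gradient : ∑ i, gradient (f i) xstar = 0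

/-- The error of `B` as an approximation of the Hessian of `g` at `x`, in the weighted norm given
by that Hessian. -/
noncomputable def hessErr {p : ℕ} (g : EuclideanSpace ℝ (Fin p) → ℝ) (x : EuclideanSpace ℝ (Fin p))
    (B : Matrix (Fin p) (Fin p) ℝ) : ℝ :=
  weightedNorm (invSqrt (hessian g x)) (B - hessian g x)

lemma hessErr_nonneg {p : ℕ} (g : EuclideanSpace ℝ (Fin p) → ℝ) (x : EuclideanSpace ℝ (Fin p))
    (B : Matrix (Fin p) (Fin p) ℝ) : 0 ≤ hessErr g x B := weightedNorm_nonneg _ _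

namespace IsIQNProblem

variable {n p : ℕ} {f : Fin n → EuclideanSpace ℝ (Fin p) → ℝ} {xstar : EuclideanSpace ℝ (Fin p)}
  {μ L Lt : ℝ}

lemma norm_applyMat_sub_le (P : IsIQNProblem f xstar μ L Lt) (i : Fin n)
    (B : Matrix (Fin p) (Fin p) ℝ) (v : EuclideanSpace ℝ (Fin p)) :
    ‖applyMat (B - hessian (f i) xstar) v‖ ≤ L * hessErr (f i) xstar B * ‖v‖ :=
  norm_applyMat_le_weightedNorm (hessian_isSymm (P.contDiff i) xstar) P.hμ P.hL.le (P.lower i)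
    (P.upper i) _ v

lemma half_mul_norm_sq_le_inner (P : IsIQNProblem f xstar μ L Lt) {i : Fin n}
    {B : Matrix (Fin p) (Fin p) ℝ} (hB : hessErr (f i) xstar B ≤ 1 / 2)
    (v : EuclideanSpace ℝ (Fin p)) : μ / 2 * ‖v‖ ^ 2 ≤ inner ℝ v (applyMat B v) := by
  have h1 := (abs_le.1 (abs_inner_applyMat_le_weightedNorm (hessian_isSymm (P.contDiff i) xstar)
    P.hμ (P.lower i) (B - hessian (f i) xstar) v)).1
  rw [sub_applyMat, inner_sub_right] at h1
  have h2 := P.lower i v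
  have h3 : 0 ≤ (inner ℝ v (applyMat (hessian (f i) xstar) v) : ℝ) :=
    le_trans (by have := P.hμ; positivity) h2
  have h4 := mul_le_mul_of_nonneg_right hB h3
  rw [hessErr] at h4
  linarith

/-- The error of the next iterate is bounded by the errors with which the quadratic models predict
the gradients at `xstar`. -/
lemma norm_iqnNext_sub_le (P : IsIQNProblem f xstar μ L Lt) (hn : 0 < n) {S : IQNState n p}
    (hB : ∀ i, (S.B i).IsSymm) (hc : ∀ i, hessErr (f i) xstar (S.B i) ≤ 1 / 2) {a : ℝ}
    (ha : ∀ i, ‖applyMat (S.B i - hessian (f i) xstar) (S.z i - xstar)‖ +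
      Lt * ‖S.z i - xstar‖ * ‖S.z i - xstar‖ ≤ a) :
    μ / 2 * ‖iqnNext f S - xstar‖ ≤ a := by
  have hn' : (0 : ℝ) < n := Nat.cast_pos.2 hn
  have hμ := P.hμ
  set A : Matrix (Fin p) (Fin p) ℝ := (1 / (n : ℝ)) • ∑ i, S.B i with hA
  have hmean : ∀ b : ℝ, (1 / (n : ℝ)) * ∑ _i : Fin n, b = b := fun b => by
    rw [Finset.sum_const, Finset.card_univ, Fintype.card_fin, nsmul_eq_mul]
    field_simp
  have hAlow : ∀ v, μ / 2 * ‖v‖ ^ 2 ≤ inner ℝ v (applyMat A v) := fun v => by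
    rw [hA, smul_applyMat, sum_applyMat, real_inner_smul_right, inner_sum]
    rw [← hmean (μ / 2 * ‖v‖ ^ 2)]
    gcongr with i
    exact P.half_mul_norm_sq_le_inner (hc i) v
  have hAsymm : A.IsSymm := by
    rw [Matrix.IsSymm, hA, Matrix.transpose_smul, Matrix.transpose_sum]
    simp only [fun i => (hB i).eq]
  have hAunit : IsUnit A.det :=
    (posDef_of_inner_lower_bound hAsymm (by positivity) hAlow).det_pos.ne'.isUnit
  set d : Fin n → EuclideanSpace ℝ (Fin p) := fun i =>
    applyMat (S.B i) (S.z i - xstar) - (gradient (f i) (S.z i) - gradient (f i) xstar) with hd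
  have hdle : ∀ i, ‖d i‖ ≤ a := fun i => by
    have h1 := norm_gradient_sub_sub_le (P.contDiff i) P.hLt.le (P.hess_lipschitz i)
      (x := xstar) (z := xstar) (z' := S.z i) (R := ‖S.z i - xstar‖) (by simp) le_rfl
    have h2 : d i = applyMat (S.B i - hessian (f i) xstar) (S.z i - xstar) -
        (gradient (f i) (S.z i) - gradient (f i) xstar -
          applyMat (hessian (f i) xstar) (S.z i - xstar)) := by
      simp only [hd, sub_applyMat]; abel
    rw [h2]
    exact (norm_sub_le _ _).trans ((add_le_add le_rfl h1).trans (ha i))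
  have hnext : applyMat A (iqnNext f S - xstar) = (1 / (n : ℝ)) • ∑ i, d i := by
    have h1 : applyMat A (iqnNext f S) = (1 / (n : ℝ)) • ∑ i, applyMat (S.B i) (S.z i) -
        (1 / (n : ℝ)) • ∑ i, gradient (f i) (S.z i) := by
      rw [iqnNext, ← mul_applyMat, Matrix.mul_nonsing_inv _ hAunit, one_applyMat]
    rw [applyMat_sub, h1, hA, smul_applyMat, sum_applyMat]
    simp only [hd, applyMat_sub, Finset.sum_sub_distrib, P.sum_gradient, smul_sub, sub_zero]
    abel
  have hnorm : ‖applyMat A (iqnNext f S - xstar)‖ ≤ a := by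
    rw [hnext, norm_smul, Real.norm_of_nonneg (by positivity), ← hmean a]
    gcongr
    exact (norm_sum_le _ _).trans (Finset.sum_le_sum fun i _ => hdle i)
  set v := iqnNext f S - xstar
  rcases (norm_nonneg v).eq_or_lt with hv | hv
  · rw [← hv, mul_zero]; exact (norm_nonneg _).trans hnorm
  · refine le_of_mul_le_mul_right ?_ hv
    calc μ / 2 * ‖v‖ * ‖v‖ = μ / 2 * ‖v‖ ^ 2 := by ring
      _ ≤ _ := hAlow v
      _ ≤ ‖v‖ * ‖applyMat A v‖ := real_inner_le_norm _ _
      _ ≤ a * ‖v‖ := by rw [mul_comm]; gcongr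

/-- While the Hessian approximations are good and the copies of the variable are close to the
minimizer, the next iterate is twice as close as the worst of these copies. -/
lemma norm_iqnNext_sub_le_half (P : IsIQNProblem f xstar μ L Lt) (hn : 0 < n) {S : IQNState n p}
    {ε δ A : ℝ} (hδ : δ ≤ 1 / 4) (hδL : 16 * L * δ ≤ μ) (hε : 8 * Lt * ε ≤ μ)
    (hB : ∀ i, (S.B i).IsSymm) (hc : ∀ i, hessErr (f i) xstar (S.B i) ≤ 2 * δ)
    (hz : ∀ i, ‖S.z i - xstar‖ ≤ ε) (hA : ∀ i, ‖S.z i - xstar‖ ≤ A) :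
    ‖iqnNext f S - xstar‖ ≤ A / 2 := by
  have hμ := P.hμ
  have hL := P.hL
  have hLt := P.hLt
  have h := P.norm_iqnNext_sub_le hn hB (fun i => (hc i).trans (by linarith)) (a := μ / 4 * A)
    fun i => by
      have hA0 : 0 ≤ A := (norm_nonneg _).trans (hA i)
      have hδ0 : 0 ≤ 2 * δ := (hessErr_nonneg _ _ _).trans (hc i)
      calc _ ≤ L * (2 * δ) * A + Lt * ε * A := by
            refine add_le_add ((P.norm_applyMat_sub_le i _ _).trans ?_) ?_
            · gcongr
              · exact hc i
              · exact hA i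
            · have := hz i
              have := hA i
              have hε0 : 0 ≤ ε := (norm_nonneg _).trans (hz i)
              gcongr
        _ = (L * (2 * δ) + Lt * ε) * A := by ring
        _ ≤ μ / 4 * A := by gcongr; linarith
  nlinarith

end IsIQNProblem

/-! ### Linear convergence and superlinear convergence of IQN -/

lemma half_le_one_sub_pow {n : ℕ} (hn : 0 < n) : (1 / 2 : ℝ) ≤ (1 - 1 / (2 * n)) ^ n := by
  have hn' : (1 : ℝ) ≤ n := Nat.one_le_cast.2 hn
  have h1 : 1 / (2 * (n : ℝ)) ≤ 2 := by
    rw [div_le_iff₀ (by positivity)]; linarith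
  have h2 := one_add_mul_le_pow (a := -(1 / (2 * (n : ℝ)))) (by linarith) n
  have h3 : 1 + (n : ℝ) * -(1 / (2 * (n : ℝ))) = 1 / 2 := by field_simp; norm_num
  rw [h3] at h2
  simpa only [sub_eq_add_neg] using h2

/-- The constants of the local analysis: the contraction factor `ρ` with `ρ ^ n ≥ 1 / 2`, and radii
`ε` and `δ` for the iterates and the Hessian approximations. The sum of `ρ ^ (u + 1)` over all `u`
is at most `2 n`. In the last field, `28 n = 7 · 2 · 2 n`: a step at time `u` costs the Hessian error
at most `7 Lt r / μ` with `r = 2 ε ρ ^ (u + 1)`, so the total growth of this error is at most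
`δ`. -/
structure IsIQNRadii (n : ℕ) (μ L Lt ρ ε δ : ℝ) : Prop where
  hn : 0 < n
  ρ_pos : 0 < ρ
  ρ_lt_one : ρ < 1
  half_le_pow : 1 / 2 ≤ ρ ^ n
  sum_le : ∀ t, ∑ u ∈ Finset.range t, ρ ^ (u + 1) ≤ 2 * n
  hε : 0 < ε
  hδ : 0 < δ
  δ_le : δ ≤ 1 / 4
  L_mul_δ_le : 16 * L * δ ≤ μ
  Lt_mul_ε_le : 8 * Lt * ε ≤ μ
  growth_le : 28 * n * (Lt * ε / μ) ≤ δ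

lemma exists_isIQNRadii {n : ℕ} (hn : 0 < n) {μ L Lt : ℝ} (hμ : 0 < μ) (hL : 0 < L)
    (hLt : 0 < Lt) : ∃ ρ ε δ : ℝ, IsIQNRadii n μ L Lt ρ ε δ := by
  have hn' : (1 : ℝ) ≤ n := Nat.one_le_cast.2 hn
  have hδ : 0 < min (1 / 4) (μ / (16 * L)) := by positivity
  set δ := min (1 / 4) (μ / (16 * L)) with hδdef
  have h1 : 1 / (2 * (n : ℝ)) < 1 := by
    rw [div_lt_iff₀ (by positivity)]; linarith
  refine ⟨1 - 1 / (2 * n), min (μ / (8 * Lt)) (δ * μ / (28 * n * Lt)), δ, ?_⟩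
  refine ⟨hn, by linarith, by have : 0 < 1 / (2 * (n : ℝ)) := by positivity
                              linarith, half_le_one_sub_pow hn, fun t => ?_,
    by positivity, hδ, min_le_left _ _, ?_, ?_, ?_⟩
  · set ρ : ℝ := 1 - 1 / (2 * n) with hρ
    have hρ0 : 0 < ρ := by linarith
    have hρ1 : ρ ≤ 1 := by rw [hρ]; linarith [show 0 < 1 / (2 * (n : ℝ)) by positivity]
    have h2 : (1 - ρ) * ∑ u ∈ Finset.range t, ρ ^ u = 1 - ρ ^ t := mul_neg_geom_sum ρ t
    have h3 : 1 - ρ = 1 / (2 * n) := by rw [hρ]; ring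
    have h4 : ∑ u ∈ Finset.range t, ρ ^ u ≤ 2 * n := by
      rw [h3, div_mul_eq_mul_div, one_mul, div_eq_iff (by positivity)] at h2
      have : 0 ≤ ρ ^ t := by positivity
      nlinarith
    refine (Finset.sum_le_sum fun u _ => ?_).trans h4
    exact pow_le_pow_of_le_one hρ0.le hρ1 (Nat.le_succ u)
  · have := (le_div_iff₀ (by positivity)).1 (min_le_right (1 / 4) (μ / (16 * L)))
    rw [← hδdef] at this
    linarith
  · have := (le_div_iff₀ (by positivity)).1
      (min_le_left (μ / (8 * Lt)) (δ * μ / (28 * n * Lt)))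
    linarith
  · have := (le_div_iff₀ (by positivity)).1
      (min_le_right (μ / (8 * Lt)) (δ * μ / (28 * n * Lt)))
    rw [← mul_div_assoc, div_le_iff₀ hμ]
    linarith

namespace IsIQNProblem

variable {n p : ℕ} {f : Fin n → EuclideanSpace ℝ (Fin p) → ℝ} {xstar : EuclideanSpace ℝ (Fin p)}
  {μ L Lt ρ ε δ : ℝ} {x₀ : EuclideanSpace ℝ (Fin p)} {B₀ : Fin n → Matrix (Fin p) (Fin p) ℝ}

/-- A copy of the variable is at most `n - 1` steps old, and `ρ ^ n ≥ 1 / 2`. -/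
lemma norm_z_sub_le (R : IsIQNRadii n μ L Lt ρ ε δ) {t : ℕ}
    (h : ∀ u ≤ t, iqnError f x₀ B₀ xstar u ≤ ε * ρ ^ u) (i : Fin n) :
    ‖(iqn f x₀ B₀ t).z i - xstar‖ ≤ 2 * ε * ρ ^ (t + 1) ∧
      ‖(iqn f x₀ B₀ t).z i - xstar‖ ≤ ε := by
  obtain ⟨τ, h1, h2, h3⟩ := exists_z_eq_iterate f x₀ B₀ t i
  have h4 := h τ h1
  rw [iqnError, ← h3] at h4
  have hρ := R.ρ_pos
  have hε := R.hε
  refine ⟨h4.trans ?_, h4.trans (mul_le_of_le_one_right hε.le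
    (pow_le_one₀ hρ.le R.ρ_lt_one.le))⟩
  have h5 : ρ ^ (τ + n) ≤ ρ ^ (t + 1) := pow_le_pow_of_le_one hρ.le R.ρ_lt_one.le (by omega)
  have h6 : ρ ^ τ * (1 / 2) ≤ ρ ^ τ * ρ ^ n :=
    mul_le_mul_of_nonneg_left R.half_le_pow (by positivity)
  rw [← pow_add] at h6
  nlinarith

/-- One step of IQN, for the function that is updated at time `t`. -/
lemma exists_hessErr_succ_le (P : IsIQNProblem f xstar μ L Lt) (R : IsIQNRadii n μ L Lt ρ ε δ)
    {t : ℕ} (h : ∀ u ≤ t + 1, iqnError f x₀ B₀ xstar u ≤ ε * ρ ^ u) {i : Fin n}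
    (hB : ((iqn f x₀ B₀ t).B i).IsSymm)
    (hc : hessErr (f i) xstar ((iqn f x₀ B₀ t).B i) ≤ 2 * δ) (hi : (i : ℕ) = t % n) :
    ∃ θ : ℝ, 0 ≤ θ ∧
      hessErr (f i) xstar ((iqn f x₀ B₀ (t + 1)).B i) ≤
        hessErr (f i) xstar ((iqn f x₀ B₀ t).B i) - θ ^ 2 / 3 +
          14 * (Lt * ε / μ) * ρ ^ (t + 1) ∧
      ‖applyMat ((iqn f x₀ B₀ t).B i - hessian (f i) xstar)
          ((iqn f x₀ B₀ (t + 1)).x - (iqn f x₀ B₀ t).z i)‖ ≤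
        L * θ * ‖(iqn f x₀ B₀ (t + 1)).x - (iqn f x₀ B₀ t).z i‖ := by
  have hρ := R.ρ_pos
  have hε := R.hε
  have hμ := P.hμ
  have hLt := P.hLt
  have hz := (norm_z_sub_le R (t := t) (fun u hu => h u (by omega)) i).1
  have hz' : ‖(iqn f x₀ B₀ (t + 1)).x - xstar‖ ≤ 2 * ε * ρ ^ (t + 1) :=
    (h (t + 1) le_rfl).trans (by
      have : 0 < ε * ρ ^ (t + 1) := by positivity
      linarith)
  have hR : Lt * (2 * ε * ρ ^ (t + 1)) / μ ≤ 1 / 2 := by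
    rw [div_le_iff₀ hμ]
    have h1 : ρ ^ (t + 1) ≤ 1 := pow_le_one₀ hρ.le R.ρ_lt_one.le
    have h2 : Lt * (2 * ε * ρ ^ (t + 1)) ≤ Lt * (2 * ε * 1) := by gcongr
    linarith [R.Lt_mul_ε_le]
  obtain ⟨θ, hθ, h1, h2⟩ := exists_weightedNorm_bfgsUpdate_le (P.contDiff i) hLt.le hμ P.hL.le rfl
    (P.lower i) (P.upper i) (P.hess_lipschitz i) hB (hc.trans (by linarith [R.δ_le])) hz hz' hR
  refine ⟨θ, hθ, ?_, h2⟩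
  rw [← (iqn_succ_of_eq f x₀ B₀ hi).2] at h1
  refine h1.trans (le_of_eq ?_)
  rw [hessErr]
  ring

/-- Linear convergence of the iterates, together with bounded deterioration of the Hessian
approximations. The two have to be proved together: the approximations stay good because the errors
of the iterates are summable. -/
lemma linear_convergence (P : IsIQNProblem f xstar μ L Lt) (R : IsIQNRadii n μ L Lt ρ ε δ)
    (hx₀ : ‖x₀ - xstar‖ ≤ ε) (hB₀ : ∀ i, (B₀ i).IsSymm)
    (hc₀ : ∀ i, hessErr (f i) xstar (B₀ i) ≤ δ) (t : ℕ) :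
    (∀ u ≤ t, iqnError f x₀ B₀ xstar u ≤ ε * ρ ^ u) ∧
      ∀ i, ((iqn f x₀ B₀ t).B i).IsSymm ∧ hessErr (f i) xstar ((iqn f x₀ B₀ t).B i) ≤ 2 * δ := by
  have hε := R.hε
  have hρ := R.ρ_pos
  have hμ := P.hμ
  have hLt := P.hLt
  have hgrowth : ∀ t, δ + 14 * (Lt * ε / μ) * ∑ u ∈ Finset.range t, ρ ^ (u + 1) ≤ 2 * δ :=
    fun t => by
      have : 14 * (Lt * ε / μ) * ∑ u ∈ Finset.range t, ρ ^ (u + 1) ≤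
          14 * (Lt * ε / μ) * (2 * n) := by gcongr; exact R.sum_le t
      linarith [R.growth_le]
  suffices h : (∀ u ≤ t, iqnError f x₀ B₀ xstar u ≤ ε * ρ ^ u) ∧
      ∀ i, ((iqn f x₀ B₀ t).B i).IsSymm ∧ hessErr (f i) xstar ((iqn f x₀ B₀ t).B i) ≤
        δ + 14 * (Lt * ε / μ) * ∑ u ∈ Finset.range t, ρ ^ (u + 1) from
    ⟨h.1, fun i => ⟨(h.2 i).1, (h.2 i).2.trans (hgrowth t)⟩⟩
  induction t with
  | zero =>
    refine ⟨fun u hu => ?_, fun i => ⟨hB₀ i, ?_⟩⟩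
    · obtain rfl : u = 0 := by omega
      simpa [iqnError, iqn] using hx₀
    · simpa [iqn] using hc₀ i
  | succ t ih =>
    obtain ⟨he, hB⟩ := ih
    have hc : ∀ i, hessErr (f i) xstar ((iqn f x₀ B₀ t).B i) ≤ 2 * δ :=
      fun i => (hB i).2.trans (hgrowth t)
    have hnext : iqnError f x₀ B₀ xstar (t + 1) ≤ ε * ρ ^ (t + 1) := by
      have := P.norm_iqnNext_sub_le_half R.hn R.δ_le R.L_mul_δ_le R.Lt_mul_ε_le
        (fun i => (hB i).1) hc (fun i => (norm_z_sub_le R he i).2)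
        (fun i => (norm_z_sub_le R he i).1)
      calc iqnError f x₀ B₀ xstar (t + 1) ≤ 2 * ε * ρ ^ (t + 1) / 2 := this
        _ = _ := by ring
    have he' : ∀ u ≤ t + 1, iqnError f x₀ B₀ xstar u ≤ ε * ρ ^ u := fun u hu => by
      rcases hu.eq_or_lt with rfl | hu
      · exact hnext
      · exact he u (by omega)
    refine ⟨he', fun i => ?_⟩
    rw [Finset.sum_range_succ, mul_add]
    by_cases hi : (i : ℕ) = t % n
    · obtain ⟨θ, -, h1, -⟩ := P.exists_hessErr_succ_le R he' (hB i).1 (hc i) hi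
      refine ⟨?_, by linarith [(hB i).2, sq_nonneg θ]⟩
      rw [(iqn_succ_of_eq f x₀ B₀ hi).2]
      exact bfgsUpdate_isSymm (hB i).1 _ _
    · rw [(iqn_succ_of_ne f x₀ B₀ hi).2]
      have : 0 ≤ 14 * (Lt * ε / μ) * ρ ^ (t + 1) := by positivity
      exact ⟨(hB i).1, by linarith [(hB i).2]⟩

/-- The Dennis–Moré property of the Hessian approximations: the error of the approximation that is
updated at time `t`, along the step of this update, is of smaller order than the step. -/
lemma exists_dennisMore (P : IsIQNProblem f xstar μ L Lt) (R : IsIQNRadii n μ L Lt ρ ε δ)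
    (hx₀ : ‖x₀ - xstar‖ ≤ ε) (hB₀ : ∀ i, (B₀ i).IsSymm)
    (hc₀ : ∀ i, hessErr (f i) xstar (B₀ i) ≤ δ) :
    ∃ θ : ℕ → ℝ, (∀ t, 0 ≤ θ t) ∧ Tendsto θ atTop (𝓝 0) ∧ ∀ t (i : Fin n), (i : ℕ) = t % n →
      ‖applyMat ((iqn f x₀ B₀ t).B i - hessian (f i) xstar)
          ((iqn f x₀ B₀ (t + 1)).x - (iqn f x₀ B₀ t).z i)‖ ≤
        L * θ t * ‖(iqn f x₀ B₀ (t + 1)).x - (iqn f x₀ B₀ t).z i‖ := by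
  have hlin := P.linear_convergence R hx₀ hB₀ hc₀
  choose θ hθ0 hθ hdm using fun t => P.exists_hessErr_succ_le R (hlin (t + 1)).1
    (i := ⟨t % n, Nat.mod_lt t R.hn⟩) ((hlin t).2 _).1 ((hlin t).2 _).2 rfl
  refine ⟨θ, hθ0, ?_, fun t i hi => ?_⟩
  swap
  · obtain rfl : i = ⟨t % n, Nat.mod_lt t R.hn⟩ := Fin.ext hi
    exact hdm t
  -- Only one summand of the sum of all Hessian errors changes at time `t`.
  have hsq : Tendsto (fun t => θ t ^ 2 / 3) atTop (𝓝 0) := by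
    refine tendsto_zero_of_telescoping
      (T := fun t => ∑ i, hessErr (f i) xstar ((iqn f x₀ B₀ t).B i))
      (a := fun t => 14 * (Lt * ε / μ) * ρ ^ (t + 1)) (A := 14 * (Lt * ε / μ) * (2 * n))
      (fun t => Finset.sum_nonneg fun i _ => hessErr_nonneg _ _ _)
      (fun t => by positivity) (fun t => ?_) (fun t => ?_)
    · have hε := R.hε
      have hμ := P.hμ
      have hLt := P.hLt
      rw [← Finset.mul_sum]
      gcongr
      exact R.sum_le t
    · set j : Fin n := ⟨t % n, Nat.mod_lt t R.hn⟩
      rw [← Finset.add_sum_erase _ _ (Finset.mem_univ j), ← Finset.add_sum_erase _ _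
        (Finset.mem_univ j)]
      have h1 : ∑ i ∈ Finset.univ.erase j, hessErr (f i) xstar ((iqn f x₀ B₀ (t + 1)).B i) =
          ∑ i ∈ Finset.univ.erase j, hessErr (f i) xstar ((iqn f x₀ B₀ t).B i) := by
        refine Finset.sum_congr rfl fun i hi => ?_
        rw [(iqn_succ_of_ne f x₀ B₀ fun h => (Finset.mem_erase.1 hi).1 (Fin.ext h)).2]
      rw [h1]
      linarith [hθ t]
  have := (hsq.const_mul 3).sqrt
  simpa [mul_div_cancel₀, Real.sqrt_sq (hθ0 _)] using this

/-- The two inequalities between the errors and their window maxima from which superlinear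
convergence follows by `eventually_windowMax_add_le`. -/
lemma iqnError_windowMax_bounds (P : IsIQNProblem f xstar μ L Lt)
    (R : IsIQNRadii n μ L Lt ρ ε δ) (hx₀ : ‖x₀ - xstar‖ ≤ ε) (hB₀ : ∀ i, (B₀ i).IsSymm)
    (hc₀ : ∀ i, hessErr (f i) xstar (B₀ i) ≤ δ) :
    (∀ t, iqnError f x₀ B₀ xstar (t + n) ≤ windowMax (iqnError f x₀ B₀ xstar) n t) ∧
    ∀ κ > 0, ∀ᶠ t in atTop, iqnError f x₀ B₀ xstar (t + n) ≤
      κ * windowMax (iqnError f x₀ B₀ xstar) n t +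
        1 / 2 * windowMax (iqnError f x₀ B₀ xstar) n (t + n) := by
  have hlin := P.linear_convergence R hx₀ hB₀ hc₀
  set e := iqnError f x₀ B₀ xstar with he
  have hn := R.hn
  have hμ := P.hμ
  have hL := P.hL
  have hLt := P.hLt
  have hW0 : ∀ t, 0 ≤ windowMax e n t := fun t =>
    (norm_nonneg _).trans (le_windowMax e t le_rfl (by omega))
  -- At time `t + n - 1` all copies of the variable are iterates from the window starting at `t`.
  have hz : ∀ t i, ‖(iqn f x₀ B₀ (t + (n - 1))).z i - xstar‖ ≤ windowMax e n t := fun t i => by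
    obtain ⟨τ, h1, h2, h3⟩ := exists_z_eq_iterate f x₀ B₀ (t + (n - 1)) i
    rw [h3]
    exact le_windowMax e t (by omega) (by omega)
  have hsucc : ∀ t, t + n = t + (n - 1) + 1 := fun t => by omega
  refine ⟨fun t => ?_, fun κ hκ => ?_⟩
  · have := P.norm_iqnNext_sub_le_half hn R.δ_le R.L_mul_δ_le R.Lt_mul_ε_le
      (fun i => ((hlin (t + (n - 1))).2 i).1) (fun i => ((hlin (t + (n - 1))).2 i).2)
      (fun i => (norm_z_sub_le R (hlin (t + (n - 1))).1 i).2) (hz t)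
    rw [hsucc]
    exact this.trans (half_le_self (hW0 t))
  · obtain ⟨θ, hθ0, hθ, hdm⟩ := P.exists_dennisMore R hx₀ hB₀ hc₀
    set η := min (μ / 8) (κ * μ / 4) with hη
    have hηpos : 0 < η := by positivity
    have hLθ : Tendsto (fun t => L * θ t) atTop (𝓝 0) := by simpa using hθ.const_mul L
    obtain ⟨T, hT⟩ := eventually_atTop.1 ((tendsto_order.1 hLθ).2 η hηpos)
    have hgeom : Tendsto (fun t => Lt * (2 * ε * ρ ^ (t + n))) atTop (𝓝 0) := by
      have h1 := (tendsto_pow_atTop_nhds_zero_of_lt_one R.ρ_pos.le R.ρ_lt_one).comp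
        (tendsto_add_atTop_nat n)
      simpa using (h1.const_mul (2 * ε)).const_mul Lt
    filter_upwards [eventually_ge_atTop T, (tendsto_order.1 hgeom).2 (κ * μ / 4) (by positivity)]
      with t ht htgeom
    set W := windowMax e n t with hW
    set W' := windowMax e n (t + n) with hW'
    have hW'0 : 0 ≤ W' := hW0 _
    have hWnn : 0 ≤ W := hW0 _
    have key : ∀ i, ‖applyMat ((iqn f x₀ B₀ (t + (n - 1))).B i - hessian (f i) xstar)
          ((iqn f x₀ B₀ (t + (n - 1))).z i - xstar)‖ +
        Lt * ‖(iqn f x₀ B₀ (t + (n - 1))).z i - xstar‖ *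
          ‖(iqn f x₀ B₀ (t + (n - 1))).z i - xstar‖ ≤
        (L * (2 * δ) + η) * W' + (η + κ * μ / 4) * W := by
      intro i
      have hzW := hz t i
      have hzsmall := (norm_z_sub_le R (hlin (t + (n - 1))).1 i).1
      rw [← hsucc] at hzsmall
      obtain ⟨u, hu1, hu2, hui, huz, huB⟩ := exists_next_update f x₀ B₀ (t + (n - 1)) i
      have hdmu := hdm u i hui
      have hcu := ((hlin u).2 i).2
      rw [huz, huB] at hdmu
      rw [huB] at hcu
      set z := (iqn f x₀ B₀ (t + (n - 1))).z i
      set D := (iqn f x₀ B₀ (t + (n - 1))).B i - hessian (f i) xstar with hD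
      set x' := (iqn f x₀ B₀ (u + 1)).x with hx'
      have hx'W : ‖x' - xstar‖ ≤ W' := le_windowMax e (t + n) (by omega) (by omega)
      have hstep : ‖x' - z‖ ≤ W' + W := by
        have h1 : x' - z = (x' - xstar) - (z - xstar) := by abel
        rw [h1]
        exact (norm_sub_le _ _).trans (add_le_add hx'W hzW)
      -- The next update of function `i` relates the copy `z` to a later iterate `x'`.
      have hsplit : applyMat D (z - xstar) = applyMat D (x' - xstar) - applyMat D (x' - z) := by
        rw [← applyMat_sub]; congr 1; abel
      have h1 : ‖applyMat D (x' - xstar)‖ ≤ L * (2 * δ) * W' := by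
        refine (P.norm_applyMat_sub_le i _ _).trans ?_
        have := R.hδ
        gcongr
      have h2 : ‖applyMat D (x' - z)‖ ≤ η * (W' + W) :=
        hdmu.trans (mul_le_mul (hT u (by omega)).le hstep (norm_nonneg _) hηpos.le)
      have h3 : Lt * ‖z - xstar‖ * ‖z - xstar‖ ≤ κ * μ / 4 * W := by
        refine mul_le_mul ?_ hzW (norm_nonneg _) (by positivity)
        exact (mul_le_mul_of_nonneg_left hzsmall hLt.le).trans htgeom.le
      rw [hsplit]
      have h4 := norm_sub_le (applyMat D (x' - xstar)) (applyMat D (x' - z))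
      linarith
    have hmain := P.norm_iqnNext_sub_le hn (fun i => ((hlin (t + (n - 1))).2 i).1)
      (fun i => ((hlin (t + (n - 1))).2 i).2.trans (by linarith [R.δ_le])) key
    have h1 : L * (2 * δ) + η ≤ μ / 4 := by
      linarith [R.L_mul_δ_le, min_le_left (μ / 8) (κ * μ / 4)]
    have h2 : η + κ * μ / 4 ≤ κ * μ / 2 := by linarith [min_le_right (μ / 8) (κ * μ / 4)]
    have h3 := mul_le_mul_of_nonneg_right h1 hW'0
    have h4 := mul_le_mul_of_nonneg_right h2 hWnn
    rw [hsucc]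
    change ‖iqnNext f (iqn f x₀ B₀ (t + (n - 1))) - xstar‖ ≤ _
    refine le_of_mul_le_mul_left ?_ (half_pos hμ)
    calc _ ≤ _ := hmain
      _ ≤ μ / 4 * W' + κ * μ / 2 * W := add_le_add h3 h4
      _ = _ := by ring

end IsIQNProblem

lemma sum_gradient_eq_zero_of_minimizer {n p : ℕ} (hn : 0 < n)
    {f : Fin n → EuclideanSpace ℝ (Fin p) → ℝ} (hf : ∀ i, Differentiable ℝ (f i))
    {xstar : EuclideanSpace ℝ (Fin p)}
    (h : ∀ x, (1 / (n : ℝ)) * ∑ i, f i xstar ≤ (1 / (n : ℝ)) * ∑ i, f i x) :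
    ∑ i, gradient (f i) xstar = 0 := by
  have hmin : IsLocalMin (fun x => ∑ i, f i x) xstar :=
    Eventually.of_forall fun x => le_of_mul_le_mul_left (h x) (by positivity)
  have h1 := hmin.fderiv_eq_zero
  rw [fderiv_fun_sum fun i _ => hf i xstar] at h1
  simp only [gradient]
  rw [← map_sum, h1, map_zero]

theorem theorem2 (n p : ℕ) (hn : 0 < n)
    (f : Fin n → EuclideanSpace ℝ (Fin p) → ℝ)
    (hf : ∀ i, ContDiff ℝ 2 (f i))
    (μ L Lt : ℝ) (hμ : 0 < μ) (hμL : μ ≤ L) (hLt : 0 < Lt)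
    (hgrad : ∀ i, ∀ x y : EuclideanSpace ℝ (Fin p),
      μ * ‖x - y‖ ^ 2 ≤ inner ℝ (gradient (f i) x - gradient (f i) y) (x - y) ∧
        inner ℝ (gradient (f i) x - gradient (f i) y) (x - y) ≤ L * ‖x - y‖ ^ 2)
    (hhess : ∀ i, ∀ x y : EuclideanSpace ℝ (Fin p),
      specNorm (hessian (f i) x - hessian (f i) y) ≤ Lt * ‖x - y‖)
    (xstar : EuclideanSpace ℝ (Fin p))
    (hxstar : ∀ x : EuclideanSpace ℝ (Fin p),
      (1 / (n : ℝ)) * ∑ i, f i xstar ≤ (1 / (n : ℝ)) * ∑ i, f i x) :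
    ∃ ε : ℝ, 0 < ε ∧ ∃ δ : ℝ, 0 < δ ∧
      ∀ (x₀ : EuclideanSpace ℝ (Fin p)) (B₀ : Fin n → Matrix (Fin p) (Fin p) ℝ),
        (∀ i, (B₀ i).PosDef) →
        ‖x₀ - xstar‖ < ε →
        (∀ i, weightedNorm (invSqrt (hessian (f i) xstar))
          (B₀ i - hessian (f i) xstar) < δ) →
        (∃ φ : ℕ → ℕ, StrictMono φ ∧
          (∀ k, φ k ∈ Finset.Ico (k * n) ((k + 1) * n) ∧
            ∀ u ∈ Finset.Ico (k * n) ((k + 1) * n),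
              iqnError f x₀ B₀ xstar u ≤ iqnError f x₀ B₀ xstar (φ k)) ∧
          QSuperlinearToZero (fun k => iqnError f x₀ B₀ xstar (φ k))) ∧
        (∃ ζ : ℕ → ℝ, (∀ t, 0 < ζ t) ∧
          (∀ t, iqnError f x₀ B₀ xstar t ≤ ζ t) ∧
          Tendsto ζ atTop (𝓝 0) ∧
          Tendsto (fun t => ζ (t + 1) / ζ t) atTop (𝓝 0)) := by
  have hL : 0 < L := hμ.trans_le hμL
  have P : IsIQNProblem f xstar μ L Lt :=
    { contDiff := hf
      hμ := hμ
      hL := hL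
      hLt := hLt
      lower := fun i v => (inner_hessian_bounds (hf i) hLt.le (hgrad i) (hhess i) xstar v).1
      upper := fun i v => (inner_hessian_bounds (hf i) hLt.le (hgrad i) (hhess i) xstar v).2
      hess_lipschitz := hhess
      sum_gradient := sum_gradient_eq_zero_of_minimizer hn
        (fun i => (hf i).differentiable (by norm_num)) hxstar }
  obtain ⟨ρ, ε, δ, R⟩ := exists_isIQNRadii hn hμ hL hLt
  refine ⟨ε, R.hε, δ, R.hδ, fun x₀ B₀ hB₀ hx₀ hc₀ => ?_⟩
  have hsymm : ∀ i, (B₀ i).IsSymm := fun i => by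
    have := (hB₀ i).isHermitian
    rwa [Matrix.IsHermitian, Matrix.conjTranspose_eq_transpose_of_trivial] at this
  have hlin := P.linear_convergence R hx₀.le hsymm fun i => (hc₀ i).le
  obtain ⟨hW₁, hW₂⟩ := P.iqnError_windowMax_bounds R hx₀.le hsymm fun i => (hc₀ i).le
  set e := iqnError f x₀ B₀ xstar
  have he0 : ∀ t, 0 ≤ e t := fun t => norm_nonneg _
  have hlim : Tendsto e atTop (𝓝 0) := by
    refine squeeze_zero he0 (fun t => (hlin t).1 t le_rfl) ?_
    simpa using (tendsto_pow_atTop_nhds_zero_of_lt_one R.ρ_pos.le R.ρ_lt_one).const_mul ε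
  have hsuper := eventually_windowMax_add_le hn hW₁ hW₂
  have hself : ∀ t, e t ≤ windowMax e n t := fun t => le_windowMax e t le_rfl (by omega)
  refine ⟨?_, ?_⟩
  · have hmax : ∀ k, ∃ u ∈ Finset.Ico (k * n) ((k + 1) * n),
        ∀ v ∈ Finset.Ico (k * n) ((k + 1) * n), e v ≤ e u := fun k =>
      Finset.exists_max_image _ _
        (Finset.nonempty_Ico.2 (Nat.mul_lt_mul_of_pos_right (Nat.lt_succ_self k) hn))
    choose φ hφ hφmax using hmax
    have hmono : StrictMono φ := strictMono_nat_of_lt_succ fun k =>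
      (Finset.mem_Ico.1 (hφ k)).2.trans_le (Finset.mem_Ico.1 (hφ (k + 1))).1
    have hφW : ∀ k, e (φ k) = windowMax e n (k * n) := fun k => by
      have hk : (k + 1) * n = k * n + n := Nat.succ_mul k n
      have h1 := Finset.mem_Ico.1 (hφ k)
      refine le_antisymm (le_windowMax e _ h1.1 (hk ▸ h1.2)) (windowMax_le hn fun u h2 h3 => ?_)
      exact hφmax k u (Finset.mem_Ico.2 ⟨h2, hk ▸ h3⟩)
    refine ⟨φ, hmono, fun k => ⟨hφ k, hφmax k⟩, hlim.comp hmono.tendsto_atTop, ?_⟩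
    refine isLittleO_iff.2 fun c hc => ?_
    have hkn : Tendsto (fun k : ℕ => k * n) atTop atTop :=
      tendsto_id.atTop_mul_const' hn
    filter_upwards [hkn.eventually (hsuper c hc)] with k hk
    rw [Real.norm_of_nonneg (he0 _), Real.norm_of_nonneg (he0 _), hφW, hφW, Nat.succ_mul]
    exact hk
  · obtain ⟨ζ, hζ0, hζ, hlimζ, hratio⟩ := exists_majorant_ratio_tendsto_zero hn
      (fun t => (he0 t).trans (hself t)) (windowMax_antitone hn hW₁) hsuper
    exact ⟨ζ, hζ0, fun t => (hself t).trans (hζ t), hlimζ, hratio⟩
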